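/- Theorem 1.2. All graphs are finite and simple; $\mathrm{dist}_G$ is the shortest-path distance ($+\infty$ between different components), and in a graph with edge weights in $\mathbb{R}_{\ge 0}$ the length of a path is the sum of its edge weights. A set of vertices is $(k,r)$-coverable in $G$ if it is contained in the union of at most $k$ balls $\{v:\mathrm{dist}_G(u,v)\le r\}$ of $G$. $G$ has doubling dimension at most $m$ if for every real $\rho\ge 0$ every ball of radius $2\rho$ can be covered by at most $2^m$ balls of radius $\rho$. A tree-partition of $G$ is a tree $T$ with a bag $\mathsf{bag}(x)\subseteq V(G)$ for each node $x$, such that every vertex lies in exactly one bag and the ends of every edge of $G$ lie in one bag or in the bags of two adjacent nodes; it has spread $r$ if any two vertices at distance at most $r$ lie in one bag or in the bags of two adjacent nodes; its maximum degree is that of $T$, its width is the maximum size of a bag, and the tree-partition width of $G$ is the minimum width of a tree-partition of $G$. A tree decomposition of $G$ is a tree with bags such that the ends of every edge lie together in some bag and, for every vertex, the nodes whose bags contain it induce a nonempty connected subtree. $G$ has distance-$r$ balanced separator number at most $k$ if for every $\mu:V(G)\to\mathbb{R}_{\ge 0}$ there is a $(k,r)$-coverable set $X$ such that every component $C$ of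 $G-X$ has $\mu(C)\le\frac12\mu(V(G))$. $G$ is $(\alpha,\beta)$-quasi-isometric with $H$ if there is $\varphi:V(G)\to V(H)$ with $\frac1\alpha\mathrm{dist}_G(u,v)-\beta\le\mathrm{dist}_H(\varphi(u),\varphi(v))\le\alpha\,\mathrm{dist}_G(u,v)+\beta$ for all $u,v\in V(G)$, and such that for every $w\in V(H)$ there is $u\in V(G)$ with $\mathrm{dist}_H(w,\varphi(u))\le\beta$. Let $m\in\mathbb{N}$ and let $\mathscr{C}$ be a class of graphs of doubling dimension at most $m$. Then for every $r\in\mathbb{N}_{>0}$ the following conditions are equivalent: 1. There exist $k_1,\Delta_1\in\mathbb{N}$ such that every member of $\mathscr{C}$ has a tree-partition of spread $r$, maximum degree at most $\Delta_1$, and with $(k_1,r)$-coverable bags. 2. There exists $k_2\in\mathbb{N}$ such that every member of $\mathscr{C}$ has a tree decomposition with $(k_2,r)$-coverable bags. 3. There exists $k_3\in\mathbb{N}$ such that every member of $\mathscr{C}$ has distance-$r$ balanced separator number at most $k_3$. 4. There exist $k_4,\Delta_4\in\mathbb{N}$ such that every member of $\mathscr{C}$ is $(3,3r)$-quasi-isometric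 with an edge-weighted graph of tree-partition width at most $k_4$, maximum degree at most $\Delta_4$, and every edge of weight $3r$. 5. There exist $k_5,\Delta_5\in\mathbb{N}$ and $\alpha,\beta,\gamma\in\mathbb{R}_{>0}$ such that every member of $\mathscr{C}$ is $(\alpha,\beta r)$-quasi-isometric with an edge-weighted graph of tree-partition width at most $k_5$, maximum degree at most $\Delta_5$, and every edge of weight at least $\gamma r$. Moreover, the constants can be bounded by functions of each other and of $m$, independently of $r$: for any two of the conditions, (i) and (j), there is a function $f$ of $m$ and of the constants of (i) such that for all $m$, $r$ and $\mathscr{C}$ as above, if (i) holds with constants $c$, then (j) holds with constants $f(m,c)$. -/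

import Mathlib

open scoped NNReal ENNReal

universe u

namespace CoarseTW

/-- A finite simple graph, bundled with its vertex type. -/
structure FiniteGraph where
  V : Type u
  [fin : Fintype V]
  graph : SimpleGraph V

attribute [instance] FiniteGraph.fin

/-- A finite simple graph with nonnegative real weights on its edges. -/
structure EdgeWeightedGraph extends FiniteGraph.{u} where
  weight : graph.edgeSet → ℝ≥0

/-- The shortest-path distance of a graph, with values in `[0, ∞]`; vertices in different
connected components are at distance `∞`. -/
noncomputable def dist {V : Type u} (G : SimpleGraph V) (u v : V) : ℝ≥0∞ :=
  ((G.edist u v : ℕ∞) : ℝ≥0∞)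

/-- The length of a walk of an edge-weighted graph: the sum of the weights of its edges. -/
noncomputable def EdgeWeightedGraph.length (H : EdgeWeightedGraph.{u}) {u v : H.V}
    (p : H.graph.Walk u v) : ℝ≥0 :=
  (p.darts.map fun d => H.weight ⟨d.edge, d.edge_mem⟩).sum

/-- The distance of an edge-weighted graph, `∞` between different components. As the weights are
nonnegative, the infimum over walks is the minimum over paths. -/
noncomputable def EdgeWeightedGraph.dist (H : EdgeWeightedGraph.{u}) (u v : H.V) : ℝ≥0∞ :=
  ⨅ p : H.graph.Walk u v, (H.length p : ℝ≥0∞)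

/-- The closed ball of radius `r` around `u`. -/
def ball {V : Type u} (G : SimpleGraph V) (u : V) (r : ℝ≥0) : Set V :=
  {v | dist G u v ≤ r}

/-- `A` is contained in the union of (at most) `k` balls of radius `r` of `G`. -/
def Coverable {V : Type u} (G : SimpleGraph V) (k : ℕ) (r : ℝ≥0) (A : Set V) : Prop :=
  ∃ S : Finset V, S.card ≤ k ∧ A ⊆ ⋃ u ∈ S, ball G u r

/-- The doubling dimension of `G` is at most `m`: for every real `r ≥ 0`, every ball of radius `2r`
can be covered by `2 ^ m` balls of radius `r`. -/
def DoublingDimLE {V : Type u} (G : SimpleGraph V) (m : ℕ) : Prop :=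
  ∀ (r : ℝ≥0) (u : V), Coverable G (2 ^ m) r (ball G u (2 * r))

/-- The maximum degree of `G` is at most `Δ`. -/
def MaxDegreeLE {V : Type u} (G : SimpleGraph V) (Δ : ℕ) : Prop :=
  ∀ v, (G.neighborSet v).encard ≤ Δ

/-- A tree decomposition of `G`. -/
structure TreeDecomposition {V : Type u} (G : SimpleGraph V) where
  node : Type u
  [node_finite : Finite node]
  tree : SimpleGraph node
  isTree : tree.IsTree
  bag : node → Set V
  edge_mem : ∀ u v, G.Adj u v → ∃ x, u ∈ bag x ∧ v ∈ bag x
  /-- The nodes whose bags contain `u` induce a nonempty connected subgraph of the tree. -/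
  connected : ∀ u, (tree.induce {x | u ∈ bag x}).Connected

/-- A tree-partition of `G`. -/
structure TreePartition {V : Type u} (G : SimpleGraph V) where
  node : Type u
  [node_finite : Finite node]
  tree : SimpleGraph node
  isTree : tree.IsTree
  bag : node → Set V
  existsUnique_mem : ∀ u, ∃! x, u ∈ bag x
  edge_mem : ∀ u v, G.Adj u v →
    (∃ x, u ∈ bag x ∧ v ∈ bag x) ∨ ∃ x y, tree.Adj x y ∧ u ∈ bag x ∧ v ∈ bag y

/-- A tree-partition has spread `r` if any two vertices at distance at most `r` lie in the same bag
or in two bags of adjacent nodes. -/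
def TreePartition.HasSpread {V : Type u} {G : SimpleGraph V} (P : TreePartition G) (r : ℕ) : Prop :=
  ∀ u v, dist G u v ≤ r →
    (∃ x, u ∈ P.bag x ∧ v ∈ P.bag x) ∨ ∃ x y, P.tree.Adj x y ∧ u ∈ P.bag x ∧ v ∈ P.bag y

/-- The tree-partition width of `G` is at most `k`. -/
def TreePartitionWidthLE {V : Type u} (G : SimpleGraph V) (k : ℕ) : Prop :=
  ∃ P : TreePartition G, ∀ x, (P.bag x).encard ≤ k

/-- The total weight `μ(A)` of a set of vertices. -/
noncomputable def weightOf {V : Type u} [Fintype V] (μ : V → ℝ≥0) (A : Set V) : ℝ≥0 :=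
  ∑ v, A.indicator μ v

/-- Every connected component of `G - X` has at most half of the total weight. -/
def IsBalancedSeparator {V : Type u} [Fintype V] (G : SimpleGraph V) (μ : V → ℝ≥0) (X : Set V) :
    Prop :=
  ∀ C : (G.induce Xᶜ).ConnectedComponent,
    weightOf μ (Subtype.val '' C.supp) ≤ weightOf μ Set.univ / 2

/-- The distance-`r` balanced separator number of `G` is at most `k`. -/
def BalancedSeparatorNumberLE {V : Type u} [Fintype V] (G : SimpleGraph V) (r : ℝ≥0) (k : ℕ) :
    Prop :=
  ∀ μ : V → ℝ≥0, ∃ X : Set V, Coverable G k r X ∧ IsBalancedSeparator G μ X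

/-- `φ` is an `(α, β)`-quasi-isometry with respect to the distances `dX` and `dY`. The lower bound
`dX u v / α - β ≤ dY (φ u) (φ v)` is written without subtraction. -/
def IsQuasiIsometry {X Y : Type u} (dX : X → X → ℝ≥0∞) (dY : Y → Y → ℝ≥0∞) (α β : ℝ≥0)
    (φ : X → Y) : Prop :=
  (∀ u v, dX u v / α ≤ dY (φ u) (φ v) + β ∧ dY (φ u) (φ v) ≤ α * dX u v + β) ∧
    ∀ w, ∃ u, dY w (φ u) ≤ β

/-- `G` is `(α, β)`-quasi-isometric with the edge-weighted graph `H`. -/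
def QuasiIsometric (G : FiniteGraph.{u}) (H : EdgeWeightedGraph.{u}) (α β : ℝ≥0) : Prop :=
  ∃ φ : G.V → H.V, IsQuasiIsometry (dist G.graph) H.dist α β φ

/-! The five conditions, for one graph, at scale `r` and with given constants. -/

/-- `G` has a tree-partition of spread `r`, maximum degree at most `Δ`, with `(k, r)`-coverable
bags. -/
def TreePartitionCond (r : ℕ) (k Δ : ℕ) (G : FiniteGraph.{u}) : Prop :=
  ∃ P : TreePartition G.graph,
    P.HasSpread r ∧ MaxDegreeLE P.tree Δ ∧ ∀ x, Coverable G.graph k r (P.bag x)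

/-- `G` has a tree decomposition with `(k, r)`-coverable bags. -/
def TreeDecompositionCond (r : ℕ) (k : ℕ) (G : FiniteGraph.{u}) : Prop :=
  ∃ D : TreeDecomposition G.graph, ∀ x, Coverable G.graph k r (D.bag x)

/-- `G` has distance-`r` balanced separator number at most `k`. -/
def SeparatorCond (r : ℕ) (k : ℕ) (G : FiniteGraph.{u}) : Prop :=
  BalancedSeparatorNumberLE G.graph r k

/-- `G` is `(3, 3r)`-quasi-isometric with an edge-weighted graph of tree-partition width at most
`k`, maximum degree at most `Δ`, and all edges of weight `3r`. -/
def QuasiIsometryCond (r : ℕ) (k Δ : ℕ) (G : FiniteGraph.{u}) : Prop :=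
  ∃ H : EdgeWeightedGraph.{u}, TreePartitionWidthLE H.graph k ∧ MaxDegreeLE H.graph Δ ∧
    (∀ e, H.weight e = 3 * r) ∧ QuasiIsometric G H 3 (3 * r)

/-- `G` is `(α, βr)`-quasi-isometric with an edge-weighted graph of tree-partition width at most
`k`, maximum degree at most `Δ`, and all edges of weight at least `γr`. -/
def GeneralQuasiIsometryCond (r : ℕ) (k Δ : ℕ) (α β γ : ℝ≥0) (G : FiniteGraph.{u}) : Prop :=
  ∃ H : EdgeWeightedGraph.{u}, TreePartitionWidthLE H.graph k ∧ MaxDegreeLE H.graph Δ ∧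
    (∀ e, γ * r ≤ H.weight e) ∧ QuasiIsometric G H α (β * r)

/-- Names of the five conditions. -/
inductive Condition where
  | treePartition
  | treeDecomposition
  | separator
  | quasiIsometry
  | generalQuasiIsometry

/-- The type of the tuple of constants of each condition: `(k₁, Δ₁)`, `k₂`, `k₃`, `(k₄, Δ₄)` and
`(k₅, Δ₅, α, β, γ)` with positive reals `α, β, γ`. -/
def Condition.Constants : Condition → Type
  | .treePartition => ℕ × ℕ
  | .treeDecomposition => ℕ
  | .separator => ℕ
  | .quasiIsometry => ℕ × ℕ
  | .generalQuasiIsometry => ℕ × ℕ × {a : ℝ≥0 // 0 < a} × {b : ℝ≥0 // 0 < b} × {c : ℝ≥0 // 0 < c}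

/-- The graph `G` satisfies the condition at scale `r` with the given constants. -/
def Condition.Holds (r : ℕ) : (i : Condition) → i.Constants → FiniteGraph.{u} → Prop
  | .treePartition, (k, Δ), G => TreePartitionCond r k Δ G
  | .treeDecomposition, k, G => TreeDecompositionCond r k G
  | .separator, k, G => SeparatorCond r k G
  | .quasiIsometry, (k, Δ), G => QuasiIsometryCond r k Δ G
  | .generalQuasiIsometry, (k, Δ, α, β, γ), G => GeneralQuasiIsometryCond r k Δ α β γ G

end CoarseTW

/-! The balanced separator number is the hub: every condition bounds it, and a bound on it yields
every condition.

Towards separators, each structure sends the vertices of `G` to nodes of a tree. For a weight on the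
vertices, push it forward to the tree and take a centroid `x` (`exists_centroid`). A walk of `G`
that avoids a suitable set attached to `x` stays on one side of `x`, so that set is a balanced
separator (`exists_isBalancedSeparator`). The set is the bag of `x`, or, for a quasi-isometry, the
preimage of a neighbourhood of the bag; doubling makes this preimage coverable.

From separators, discretize at scale `r`. A maximal set `N` of vertices at pairwise distance more
than `r`, with an edge between points at distance at most `3r`, is a graph of degree at most `8 ^ m`
by doubling. Separators of `G` coverable by few `r`-balls become separators of `N` with few vertices
(`hasSeparators_netGraph`). A graph of bounded degree with small separators has a tree-partition of
bounded width and degree (`exists_isListPartition`): absorb the neighbours of the current root bag,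
and split along a separator once the root bag is large. Sending each vertex of `G` to a nearby net
point carries this tree-partition back to `G`, and the same map is the required quasi-isometry. -/

namespace CoarseTW

/-! ### Distances, coverings and packings under bounded doubling dimension -/

section Metric

variable {V : Type u} {G : SimpleGraph V}

theorem dist_self (u : V) : dist G u u = 0 := by simp [dist]

theorem dist_comm (u v : V) : dist G u v = dist G v u := by
  rw [dist, SimpleGraph.edist_comm, dist]

theorem dist_triangle (u v w : V) : dist G u w ≤ dist G u v + dist G v w := by
  rw [dist, dist, dist, ← ENat.toENNReal_add, ENat.toENNReal_le]
  exact SimpleGraph.edist_triangle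

theorem dist_le_length {u v : V} (p : G.Walk u v) : dist G u v ≤ p.length := by
  have h := ENat.toENNReal_le.2 (SimpleGraph.edist_le p)
  simpa [dist] using h

theorem dist_le_one_of_adj {u v : V} (h : G.Adj u v) : dist G u v ≤ 1 := by
  simpa using dist_le_length h.toWalk

theorem exists_walk_of_dist_ne_top {u v : V} (h : dist G u v ≠ ⊤) :
    ∃ p : G.Walk u v, (p.length : ℝ≥0∞) = dist G u v := by
  obtain ⟨p, hp⟩ := SimpleGraph.exists_walk_of_edist_ne_top (G := G) (u := u) (v := v)
    (by rintro h'; simp [dist, h'] at h)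
  exact ⟨p, by rw [dist, ← hp]; simp⟩

theorem exists_walk_of_dist_le {u v : V} {n : ℕ} (h : dist G u v ≤ n) :
    ∃ p : G.Walk u v, p.length ≤ n := by
  obtain ⟨p, hp⟩ := exists_walk_of_dist_ne_top (G := G) (u := u) (v := v)
    (ne_top_of_le_ne_top (by simp) h)
  exact ⟨p, by rw [← hp] at h; exact_mod_cast h⟩

theorem mem_ball {u v : V} {r : ℝ≥0} : v ∈ ball G u r ↔ dist G u v ≤ r := Iff.rfl

theorem Coverable.subset {k : ℕ} {r : ℝ≥0} {A B : Set V} (h : Coverable G k r B) (hA : A ⊆ B) :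
    Coverable G k r A :=
  let ⟨S, hS, hB⟩ := h
  ⟨S, hS, hA.trans hB⟩

theorem Coverable.mono {k l : ℕ} {r : ℝ≥0} {A : Set V} (h : Coverable G k r A) (hkl : k ≤ l) :
    Coverable G l r A :=
  let ⟨S, hS, hA⟩ := h
  ⟨S, hS.trans hkl, hA⟩

theorem Coverable.biUnion {ι : Type*} {k : ℕ} {r : ℝ≥0} (M : Finset ι) {B : ι → Set V}
    (hB : ∀ i ∈ M, Coverable G k r (B i)) : Coverable G (M.card * k) r (⋃ i ∈ M, B i) := by
  classical
  choose! S hS hBS using hB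
  refine ⟨M.biUnion S, Finset.card_biUnion_le_card_mul _ _ _ hS, ?_⟩
  intro v hv
  simp only [Set.mem_iUnion] at hv ⊢
  obtain ⟨i, hi, hv⟩ := hv
  have := hBS i hi hv
  simp only [Set.mem_iUnion] at this
  obtain ⟨w, hw, hv⟩ := this
  exact ⟨w, Finset.mem_biUnion.2 ⟨i, hi, hw⟩, hv⟩

theorem coverable_empty (k : ℕ) (r : ℝ≥0) : Coverable G k r ∅ :=
  ⟨∅, by simp, by simp⟩

theorem DoublingDimLE.coverable_ball {m : ℕ} (h : DoublingDimLE G m) (r : ℝ≥0) (u : V) (j : ℕ) :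
    Coverable G ((2 ^ m) ^ j) r (ball G u (2 ^ j * r)) := by
  induction j generalizing u with
  | zero => exact ⟨{u}, by simp, by simp⟩
  | succ j ih =>
    obtain ⟨S, hS, hu⟩ := h (2 ^ j * r) u
    rw [pow_succ' 2 j, mul_assoc, pow_succ' _ j]
    refine ((Coverable.biUnion S fun v _ => ih v).mono ?_).subset hu
    exact Nat.mul_le_mul_right _ hS

/-- A set whose points are pairwise at distance more than `r` meets every ball of radius
`2 ^ j * (r / 2)` in a bounded number of points. -/
theorem DoublingDimLE.ncard_separated_le {m : ℕ} (h : DoublingDimLE G m) {r : ℝ≥0} {A : Set V}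
    (hA : ∀ a ∈ A, ∀ b ∈ A, dist G a b ≤ r → a = b) (u : V) (j : ℕ)
    (hu : A ⊆ ball G u (2 ^ j * (r / 2))) : A.Finite ∧ A.ncard ≤ (2 ^ m) ^ j := by
  classical
  obtain ⟨S, hS, hcov⟩ := h.coverable_ball (r / 2) u j
  have key : ∀ a ∈ A, ∃ s ∈ S, dist G s a ≤ (r / 2 : ℝ≥0) := fun a ha => by
    simpa [mem_ball] using hcov (hu ha)
  choose! f hf hfd using key
  -- A ball of radius `r / 2` contains at most one point of `A`, because two of its points are at
  -- distance at most `r`.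
  have hinj : Set.InjOn f A := fun a ha b hb hab => by
    refine hA a ha b hb ?_
    calc dist G a b ≤ dist G a (f a) + dist G (f a) b := dist_triangle _ _ _
      _ ≤ (r / 2 : ℝ≥0) + (r / 2 : ℝ≥0) := by
          gcongr
          · rw [dist_comm]; exact hfd a ha
          · rw [hab]; exact hfd b hb
      _ = r := by rw [← ENNReal.coe_add, add_halves]
  have hmaps : Set.MapsTo f A (S : Set V) := fun a ha => hf a ha
  refine ⟨Set.Finite.of_injOn hmaps hinj S.finite_toSet, ?_⟩
  calc A.ncard ≤ (S : Set V).ncard := Set.ncard_le_ncard_of_injOn f hmaps hinj S.finite_toSet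
    _ ≤ _ := by rwa [Set.ncard_coe_finset]

end Metric

/-! ### Weights, centroids of trees, and separators indexed by tree nodes -/

section Weight

variable {V : Type u} [Fintype V] {μ : V → ℝ≥0}

theorem weightOf_mono {A B : Set V} (h : A ⊆ B) : weightOf μ A ≤ weightOf μ B :=
  Finset.sum_le_sum fun _ _ => Set.indicator_le_indicator_of_subset h (fun _ => zero_le) _

theorem weightOf_union {A B : Set V} (h : Disjoint A B) :
    weightOf μ (A ∪ B) = weightOf μ A + weightOf μ B := by
  simp only [weightOf, Set.indicator_union_of_disjoint h, Finset.sum_add_distrib]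

end Weight

section Centroid

variable {T : Type*} {G : SimpleGraph T}

/-- `a` and `b` are joined by a walk that avoids `x`. -/
def JoinedAvoiding (G : SimpleGraph T) (x a b : T) : Prop :=
  ∃ p : G.Walk a b, x ∉ p.support

theorem JoinedAvoiding.symm {x a b : T} (h : JoinedAvoiding G x a b) : JoinedAvoiding G x b a :=
  let ⟨p, hp⟩ := h
  ⟨p.reverse, by simpa using hp⟩

theorem JoinedAvoiding.trans {x a b c : T} (h : JoinedAvoiding G x a b)
    (h' : JoinedAvoiding G x b c) : JoinedAvoiding G x a c :=
  let ⟨p, hp⟩ := h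
  let ⟨q, hq⟩ := h'
  ⟨p.append q, by simp [SimpleGraph.Walk.mem_support_append_iff, hp, hq]⟩

theorem JoinedAvoiding.refl {x a : T} (h : a ≠ x) : JoinedAvoiding G x a a :=
  ⟨.nil, by simpa using h.symm⟩

theorem JoinedAvoiding.of_adj {x a b : T} (h : G.Adj a b) (ha : a ≠ x) (hb : b ≠ x) :
    JoinedAvoiding G x a b :=
  ⟨h.toWalk, by simp [ha.symm, hb.symm]⟩

theorem JoinedAvoiding.ne_right {x a b : T} (h : JoinedAvoiding G x a b) : b ≠ x := by
  rintro rfl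
  obtain ⟨p, hp⟩ := h
  exact hp p.end_mem_support

theorem JoinedAvoiding.reachable_deleteEdges {x y a b : T} (h : JoinedAvoiding G x a b) :
    (G.deleteEdges {s(x, y)}).Reachable a b := by
  obtain ⟨p, hp⟩ := h
  exact SimpleGraph.reachable_deleteEdges_iff_exists_walk.2
    ⟨p, fun h => hp (p.fst_mem_support_of_mem_edges h)⟩

/-- The first step of a path from `x` leads to a neighbour joined to the end while avoiding `x`. -/
theorem exists_adj_joinedAvoiding (hG : G.Connected) {x a : T} (h : a ≠ x) :
    ∃ y, G.Adj x y ∧ JoinedAvoiding G x y a := by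
  obtain ⟨p, hp⟩ := (hG.preconnected x a).exists_isPath
  cases p with
  | nil => exact absurd rfl h
  | cons hxy q => exact ⟨_, hxy, q, ((SimpleGraph.Walk.cons_isPath_iff _ _).1 hp).2⟩

theorem not_reachable_deleteEdges (hG : G.IsTree) {x y : T} (h : G.Adj x y) :
    ¬ (G.deleteEdges {s(x, y)}).Reachable x y :=
  SimpleGraph.isBridge_iff.1 (SimpleGraph.isAcyclic_iff_forall_adj_isBridge.1 hG.isAcyclic h)

/-- The two walks both miss the edge `xy`, so together they would join its ends without it; but
every edge of a tree is a bridge. -/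
theorem not_joinedAvoiding_both (hG : G.IsTree) {x y w : T} (h : G.Adj x y)
    (h₁ : JoinedAvoiding G x y w) (h₂ : JoinedAvoiding G y x w) : False := by
  refine not_reachable_deleteEdges hG h ?_
  have := h₂.reachable_deleteEdges (y := x)
  rw [Sym2.eq_swap] at this
  exact this.trans (h₁.reachable_deleteEdges (y := y)).symm

theorem not_joinedAvoiding_of_adj_adj (hG : G.IsTree) {x y z : T} (hx : G.Adj x y) (hz : G.Adj y z)
    (hzx : z ≠ x) : ¬ JoinedAvoiding G y z x := by
  intro h
  refine not_joinedAvoiding_both hG hx ?_ h.symm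
  exact .of_adj hz hx.ne' hzx

/-- In a finite tree with weights on the nodes there is a node `x` such that every component of the
tree minus `x` has at most half of the total weight. -/
theorem exists_centroid [Fintype T] (hG : G.IsTree) (ν : T → ℝ≥0) :
    ∃ x, ∀ y, weightOf ν {z | JoinedAvoiding G x y z} ≤ weightOf ν Set.univ / 2 := by
  classical
  by_contra! hcon
  have step : ∀ x, ∃ y, G.Adj x y ∧ weightOf ν Set.univ / 2 <
      weightOf ν {z | JoinedAvoiding G x y z} := by
    intro x
    obtain ⟨y, hy⟩ := hcon x
    have hne : ({z | JoinedAvoiding G x y z} : Set T).Nonempty := by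
      rw [Set.nonempty_iff_ne_empty]
      intro h
      rw [h] at hy
      simp [weightOf] at hy
    obtain ⟨z, hz⟩ := hne
    obtain ⟨y', hy', hj⟩ := exists_adj_joinedAvoiding hG.connected hz.symm.ne_right
    refine ⟨y', hy', hy.trans_le (weightOf_mono fun w hw => ?_)⟩
    exact JoinedAvoiding.trans hj hw
  obtain ⟨x₀⟩ := hG.connected.nonempty
  obtain ⟨y₀, hy₀⟩ := step x₀
  -- Among the oriented edges with more than half of the weight beyond them, take one with the
  -- fewest nodes beyond it. The heavy edge leaving its head either turns back, giving two disjoint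
  -- sets that each exceed half of the weight, or has strictly fewer nodes beyond it.
  let P : Finset (T × T) := Finset.univ.filter fun e => G.Adj e.1 e.2 ∧
    weightOf ν Set.univ / 2 < weightOf ν {z | JoinedAvoiding G e.1 e.2 z}
  obtain ⟨⟨x, y⟩, hP, hmin⟩ := P.exists_min_image
    (fun e => ({z | JoinedAvoiding G e.1 e.2 z} : Set T).ncard) ⟨(x₀, y₀), by simpa [P] using hy₀⟩
  simp only [P, Finset.mem_filter, Finset.mem_univ, true_and, Prod.forall] at hP hmin
  obtain ⟨hxy, hw⟩ := hP
  obtain ⟨z, hyz, hw'⟩ := step y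
  by_cases hzx : z = x
  · subst hzx
    have hdisj : Disjoint {w | JoinedAvoiding G z y w} {w | JoinedAvoiding G y z w} :=
      Set.disjoint_left.2 fun w h₁ h₂ => not_joinedAvoiding_both hG hxy h₁ h₂
    have := (weightOf_union (μ := ν) hdisj).symm.trans_le (weightOf_mono (Set.subset_univ _))
    have h2 := (add_lt_add hw hw').trans_le this
    rw [add_halves] at h2
    exact lt_irrefl _ h2
  · refine (hmin y z ⟨hyz, hw'⟩).not_gt (Set.ncard_lt_ncard ?_ (Set.toFinite _))
    refine (Set.ssubset_iff_of_subset fun w hw => ?_).2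
      ⟨y, JoinedAvoiding.refl hxy.ne', fun h => JoinedAvoiding.ne_right h rfl⟩
    obtain ⟨p, hp⟩ := hw
    -- Everything beyond `yz` is also beyond `xy`: a walk from `z` that avoids `y` cannot reach `x`,
    -- the neighbour of `y` on the other side.
    have hpx : x ∉ p.support := fun hx => not_joinedAvoiding_of_adj_adj hG hxy hyz hzx
      ⟨p.takeUntil x hx, fun h => hp (p.support_takeUntil_subset_support hx h)⟩
    exact (JoinedAvoiding.of_adj hyz hxy.ne' hzx).trans ⟨p, hpx⟩

/-- Sets `X x` of vertices indexed by the nodes of a tree, each separating the vertices as its node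
separates the tree, include a balanced separator. -/
theorem exists_isBalancedSeparator [Finite T] (hG : G.IsTree) {V : Type u} [Fintype V]
    {H : SimpleGraph V} (n : V → T) (X : T → Set V) (hn : ∀ x, ∀ u ∉ X x, n u ≠ x)
    (hX : ∀ x u v, u ∉ X x → v ∉ X x → H.Adj u v → JoinedAvoiding G x (n u) (n v)) (μ : V → ℝ≥0) :
    ∃ x, IsBalancedSeparator H μ (X x) := by
  classical
  have := Fintype.ofFinite T
  -- The push-forward of `μ` along `n`; its centroid is the node sought.
  let ν : T → ℝ≥0 := fun t => ∑ v with n v = t, μ v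
  have hν : ∀ A : Set T, weightOf ν A = weightOf μ (n ⁻¹' A) := fun A => by
    simp only [weightOf, ν, Set.indicator_apply, Set.mem_preimage]
    rw [← Finset.sum_filter, ← Finset.sum_filter,
      Finset.sum_comm' (t' := {v | n v ∈ A}) (s' := fun v => {n v})]
    · simp
    · intro t v
      simp only [Finset.mem_filter, Finset.mem_univ, true_and, Finset.mem_singleton]
      constructor
      · rintro ⟨h, rfl⟩; exact ⟨rfl, h⟩
      · rintro ⟨rfl, h⟩; exact ⟨h, rfl⟩
  obtain ⟨x, hx⟩ := exists_centroid hG ν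
  refine ⟨x, fun C => ?_⟩
  -- Hence a component of the complement of `X x` is mapped by `n` to one side of `x`, which has at
  -- most half of the weight.
  have hwalk : ∀ a b : ((X x)ᶜ : Set V), (H.induce (X x)ᶜ).Walk a b →
      JoinedAvoiding G x (n a) (n b) := by
    intro a b p
    induction p with
    | @nil a => exact .refl (hn x _ a.2)
    | @cons a b _ h _ ih => exact .trans (hX x _ _ a.2 b.2 h) ih
  obtain ⟨a, ha⟩ := C.exists_rep
  have h := hx (n a)
  rw [hν, hν, Set.preimage_univ] at h
  refine (weightOf_mono ?_).trans h
  rintro _ ⟨b, hb, rfl⟩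
  have hab : (H.induce (X x)ᶜ).Reachable a b :=
    SimpleGraph.ConnectedComponent.exact (ha.trans hb.symm)
  obtain ⟨p⟩ := hab
  exact hwalk a b p

end Centroid

/-! ### From tree structures and quasi-isometries to balanced separators -/

section ToSeparator

theorem TreePartitionCond.separatorCond {r k Δ : ℕ} {G : FiniteGraph.{u}}
    (h : TreePartitionCond r k Δ G) : SeparatorCond r k G := by
  obtain ⟨P, -, -, hcov⟩ := h
  intro μ
  have := P.node_finite
  choose n hn huniq using P.existsUnique_mem
  obtain ⟨x, hx⟩ := exists_isBalancedSeparator (H := G.graph) P.isTree n P.bag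
    (by rintro x u hu rfl; exact hu (hn u)) (fun x u v hu hv huv => by
      have hnu : n u ≠ x := by rintro rfl; exact hu (hn u)
      have hnv : n v ≠ x := by rintro rfl; exact hv (hn v)
      obtain ⟨y, hyu, hyv⟩ | ⟨y, z, hyz, hyu, hzv⟩ := P.edge_mem u v huv
      · rw [← huniq v y hyv, huniq u y hyu]
        exact .refl hnu
      · rw [← huniq u y hyu, ← huniq v z hzv]
        rw [← huniq u y hyu] at hnu
        rw [← huniq v z hzv] at hnv
        exact .of_adj hyz hnu hnv) μ
  exact ⟨_, hcov x, hx⟩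

/-- Let `n u` be any node whose bag contains `u`. If `u` and `v` are adjacent and outside the bag of
`x`, their subtrees avoid `x` and share a node, so they join `n u` to `n v` without passing through
`x`. -/
theorem TreeDecompositionCond.separatorCond {r k : ℕ} {G : FiniteGraph.{u}}
    (h : TreeDecompositionCond r k G) : SeparatorCond r k G := by
  obtain ⟨D, hcov⟩ := h
  intro μ
  have := D.node_finite
  have hjoin : ∀ x u, u ∉ D.bag x → ∀ a b, u ∈ D.bag a → u ∈ D.bag b →
      JoinedAvoiding D.tree x a b := by
    intro x u hu a b ha hb
    have hne : ∀ c : {x | u ∈ D.bag x}, c.1 ≠ x := by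
      rintro c rfl
      exact hu c.2
    have hwalk : ∀ a b : {x | u ∈ D.bag x}, (D.tree.induce _).Walk a b →
        JoinedAvoiding D.tree x a b := by
      intro a b p
      induction p with
      | @nil a => exact .refl (hne a)
      | @cons a b _ h _ ih => exact .trans (.of_adj h (hne a) (hne b)) ih
    obtain ⟨p⟩ := (D.connected u).preconnected ⟨a, ha⟩ ⟨b, hb⟩
    exact hwalk _ _ p
  have hne : ∀ u, ∃ x, u ∈ D.bag x := fun u => by
    obtain ⟨x⟩ := (D.connected u).nonempty
    exact ⟨x, x.2⟩
  choose n hn using hne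
  obtain ⟨x, hx⟩ := exists_isBalancedSeparator (H := G.graph) D.isTree n D.bag
    (by rintro x u hu rfl; exact hu (hn u)) (fun x u v hu hv huv => by
      obtain ⟨y, hyu, hyv⟩ := D.edge_mem u v huv
      exact (hjoin x u hu _ _ (hn u) hyu).trans (hjoin x v hv _ _ hyv (hn v))) μ
  exact ⟨_, hcov x, hx⟩

theorem exists_finset_neighbors {W : Type u} {H : SimpleGraph W} {Δ : ℕ}
    (hΔ : MaxDegreeLE H Δ) (v : W) :
    ∃ N : Finset W, N.card ≤ Δ ∧ ∀ w, H.Adj v w → w ∈ N := by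
  have hf := Set.finite_of_encard_le_coe (hΔ v)
  refine ⟨hf.toFinset, ?_, fun w hw => by simpa using hw⟩
  have := hΔ v
  rw [hf.encard_eq_coe_toFinset_card] at this
  exact_mod_cast this

/-- The number of vertices of a graph of maximum degree `Δ` that are within `L` steps of a given set
of `k` vertices is bounded. -/
theorem exists_walk_neighborhood {W : Type u} {H : SimpleGraph W} {Δ : ℕ} (hΔ : MaxDegreeLE H Δ)
    {k : ℕ} {B : Set W} (hB : B.encard ≤ k) (L : ℕ) :
    ∃ M : Finset W, M.card ≤ k * (Δ + 1) ^ L ∧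
      ∀ b ∈ B, ∀ w, ∀ p : H.Walk b w, p.length ≤ L → w ∈ M := by
  classical
  have hnb : ∀ w, ∃ N : Finset W, N.card ≤ Δ + 1 ∧ w ∈ N ∧ ∀ v, H.Adj w v → v ∈ N := by
    intro w
    obtain ⟨N, hN, hadj⟩ := exists_finset_neighbors hΔ w
    exact ⟨insert w N, (Finset.card_insert_le _ _).trans (Nat.succ_le_succ hN), by simp,
      fun v hv => by simp [hadj v hv]⟩
  choose N hN hself hadj using hnb
  induction L with
  | zero =>
    have hf := Set.finite_of_encard_le_coe hB
    rw [hf.encard_eq_coe_toFinset_card] at hB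
    refine ⟨hf.toFinset, by simpa using hB, fun b hb w p hp => ?_⟩
    have := SimpleGraph.Walk.eq_of_length_eq_zero (p := p) (by omega)
    simpa [← this] using hb
  | succ L ih =>
    obtain ⟨M, hM, hMw⟩ := ih
    refine ⟨M.biUnion N, ?_, fun b hb w p hp => ?_⟩
    · rw [pow_succ, ← mul_assoc]
      exact (Finset.card_biUnion_le_card_mul _ _ _ fun a _ => hN a).trans
        (Nat.mul_le_mul_right _ hM)
    · rw [Finset.mem_biUnion]
      by_cases hp' : p.length ≤ L
      · exact ⟨w, hMw b hb w p hp', hself w⟩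
      · have hnil : ¬ p.Nil := by
          rw [← SimpleGraph.Walk.length_eq_zero_iff]; omega
        refine ⟨p.penultimate, hMw b hb _ p.dropLast ?_, hadj _ _ (p.adj_penultimate hnil)⟩
        have : p.dropLast.length = p.length - 1 := by simp
        omega

theorem length_mul_le {H : EdgeWeightedGraph.{u}} {c : ℝ≥0} (hc : ∀ e, c ≤ H.weight e) {u v : H.V}
    (p : H.graph.Walk u v) : p.length * c ≤ H.length p := by
  unfold EdgeWeightedGraph.length
  induction p with
  | nil => simp
  | cons h p ih =>
    simp only [SimpleGraph.Walk.length_cons, SimpleGraph.Walk.darts_cons, List.map_cons,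
      List.sum_cons, Nat.cast_add, Nat.cast_one, add_mul, one_mul]
    rw [add_comm]
    exact add_le_add (hc _) ih

/-- The bound on the balanced separator number derived from a quasi-isometry. -/
noncomputable def quasiIsometrySeparatorBound (m k Δ : ℕ) (α β γ : ℝ≥0) : ℕ :=
  k * (Δ + 1) ^ (⌈(α + β) / γ⌉₊ + 1) * (2 ^ m) ^ ⌈α * β⌉₊

/-- The ends of an edge of `G` have images at distance at most `α + βr ≤ (α + β)r`, and edges of `H`
weigh at least `γr`, so the images are joined by a walk of at most `L` edges. Therefore the preimage
of the `L`-step neighbourhood of a bag separates `G` as the bag separates `H`. This neighbourhood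
has at most `k(Δ + 1)^L` vertices. Each of their fibres lies in a ball of radius `αβr`, and `αβ ≤ 2
^ ⌈αβ⌉`, so `⌈αβ⌉` doublings cover a fibre by balls of radius `r`. -/
theorem GeneralQuasiIsometryCond.separatorCond {r m k Δ : ℕ} {α β γ : ℝ≥0} (hr : 0 < r)
    (hα : 0 < α) (hγ : 0 < γ) {G : FiniteGraph.{u}} (hG : DoublingDimLE G.graph m)
    (h : GeneralQuasiIsometryCond r k Δ α β γ G) :
    SeparatorCond r (quasiIsometrySeparatorBound m k Δ α β γ) G := by
  obtain ⟨H, ⟨P, hwidth⟩, hΔ, hweight, φ, hφ, -⟩ := h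
  intro μ
  have := P.node_finite
  set L := ⌈(α + β) / γ⌉₊ + 1 with hL
  have hr' : (1 : ℝ≥0) ≤ r := by exact_mod_cast hr
  have hhop : ∀ u v, G.graph.Adj u v → ∃ p : H.graph.Walk (φ u) (φ v), p.length ≤ L := by
    intro u v huv
    -- The slack `γr` makes the bound on the infimum strict, so that some walk satisfies it; it
    -- costs the `+ 1` in `L`.
    have h1 : H.dist (φ u) (φ v) < ((α + β) * r + γ * r : ℝ≥0) := by
      calc H.dist (φ u) (φ v) ≤ α * dist G.graph u v + (β * r : ℝ≥0) := (hφ u v).2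
        _ ≤ α * 1 + (β * r : ℝ≥0) := by gcongr; exact dist_le_one_of_adj huv
        _ = (α * 1 + β * r : ℝ≥0) := by push_cast; rfl
        _ < ((α + β) * r + γ * r : ℝ≥0) := by
            rw [ENNReal.coe_lt_coe]
            have : 0 < γ * r := by positivity
            calc α * 1 + β * r ≤ α * r + β * r := by gcongr
              _ < α * r + β * r + γ * r := lt_add_of_pos_right _ this
              _ = _ := by ring
    obtain ⟨p, hp⟩ := iInf_lt_iff.1 h1
    rw [ENNReal.coe_lt_coe] at hp
    refine ⟨p, ?_⟩
    have h2 := (length_mul_le hweight p).trans_lt hp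
    have h3 : (p.length : ℝ≥0) * γ < (α + β) + γ := by
      have : (p.length * γ) * (r : ℝ≥0) < ((α + β) + γ) * r := by
        calc _ = p.length * (γ * r) := by ring
          _ < _ := h2
          _ = _ := by ring
      exact lt_of_mul_lt_mul_right this (by positivity)
    have h4 : (p.length : ℝ≥0) ≤ (α + β) / γ + 1 := by
      rw [div_add_one hγ.ne', le_div_iff₀ hγ]
      exact h3.le
    have h5 : (p.length : ℝ≥0) ≤ (L : ℝ≥0) := by
      rw [hL]; push_cast
      exact h4.trans (by gcongr; exact Nat.le_ceil _)
    exact_mod_cast h5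
  have hnbhd := fun x => exists_walk_neighborhood hΔ (hwidth x) L
  choose M hMcard hM using hnbhd
  choose n hn huniq using P.existsUnique_mem
  have hjoin : ∀ x a b (p : H.graph.Walk a b), (∀ w ∈ p.support, w ∉ P.bag x) →
      JoinedAvoiding P.tree x (n a) (n b) := by
    intro x a b p hp
    induction p with
    | nil => exact .refl (by rintro rfl; exact hp _ (by simp) (hn _))
    | @cons a b c hab p ih =>
      refine JoinedAvoiding.trans ?_ (ih fun w hw => hp w (by simp [hw]))
      have hna : n a ≠ x := by rintro rfl; exact hp a (by simp) (hn _)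
      have hnb : n b ≠ x := by rintro rfl; exact hp b (by simp) (hn _)
      obtain ⟨y, hya, hyb⟩ | ⟨y, z, hyz, hya, hzb⟩ := P.edge_mem _ _ hab
      · rw [← huniq _ y hyb, huniq _ y hya]
        exact .refl hna
      · rw [huniq _ y hya, huniq _ z hzb] at hyz
        exact .of_adj hyz hna hnb
  have hbag : ∀ x u, u ∉ φ ⁻¹' (M x) → n (φ u) ≠ x := by
    rintro x u hu rfl
    exact hu (hM _ _ (hn _) _ .nil (by simp))
  obtain ⟨x, hx⟩ := exists_isBalancedSeparator (H := G.graph) P.isTree (fun u => n (φ u))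
    (fun x => φ ⁻¹' (M x)) hbag (fun x u v hu hv huv => by
      classical
      obtain ⟨p, hp⟩ := hhop u v huv
      -- If the walk met the bag of `x` at `w`, its initial segment, reversed, would place `φ u`
      -- within `L` steps of the bag.
      refine hjoin x _ _ p fun w hw hwx => hu ?_
      refine hM x w hwx _ (p.takeUntil w hw).reverse ?_
      rw [SimpleGraph.Walk.length_reverse]
      exact (p.length_takeUntil_le_length hw).trans hp) μ
  refine ⟨_, ?_, hx⟩
  have hfib : ∀ w ∈ M x, Coverable G.graph ((2 ^ m) ^ ⌈α * β⌉₊) r (φ ⁻¹' {w}) := by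
    intro w _
    by_cases hw : ∃ u, φ u = w
    · obtain ⟨u, rfl⟩ := hw
      refine (hG.coverable_ball r u ⌈α * β⌉₊).subset ?_
      intro v hv
      have hv' : φ v = φ u := hv
      have h1 := (hφ u v).1
      have h0 : H.dist (φ u) (φ v) = 0 := by
        rw [hv', ← nonpos_iff_eq_zero]
        exact (iInf_le _ .nil).trans (by simp [EdgeWeightedGraph.length])
      rw [h0, zero_add, ENNReal.div_le_iff (by exact_mod_cast hα.ne') (by simp)] at h1
      refine h1.trans ?_
      rw [← ENNReal.coe_mul, ENNReal.coe_le_coe]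
      calc β * r * α = (α * β) * r := by ring
        _ ≤ 2 ^ ⌈α * β⌉₊ * r := by
          gcongr
          calc α * β ≤ ⌈α * β⌉₊ := Nat.le_ceil _
            _ ≤ 2 ^ ⌈α * β⌉₊ := by exact_mod_cast Nat.lt_two_pow_self.le
    · refine (coverable_empty _ _).subset ?_
      intro v hv
      exact hw ⟨v, hv⟩
  refine ((Coverable.biUnion (M x) hfib).mono ?_).subset ?_
  · exact Nat.mul_le_mul_right _ (hMcard x)
  · intro v hv
    simpa using hv

end ToSeparator

/-! ### Tree-partitions of bounded-degree graphs with small separators, with words as nodes -/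

section ListPartition

/-- Words are the nodes of a tree rooted at the empty word, in which the children of a word extend it
by one letter. Two words are near if they are equal or adjacent in this tree. -/
def Near (l l' : List ℕ) : Prop :=
  l = l' ∨ (∃ c, l' = l ++ [c]) ∨ ∃ c, l = l' ++ [c]

theorem Near.refl (l : List ℕ) : Near l l := .inl rfl

theorem Near.symm {l l' : List ℕ} (h : Near l l') : Near l' l :=
  h.elim (fun h => .inl h.symm) fun h => .inr h.symm

theorem Near.cons {l l' : List ℕ} (h : Near l l') (a : ℕ) : Near (a :: l) (a :: l') := by
  obtain rfl | ⟨c, rfl⟩ | ⟨c, rfl⟩ := h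
  · exact .refl _
  · exact .inr (.inl ⟨c, rfl⟩)
  · exact .inr (.inr ⟨c, rfl⟩)

theorem near_nil_singleton (a : ℕ) : Near [] [a] := .inr (.inl ⟨a, rfl⟩)

/-- Renumber the children of the root. -/
def shiftHead (d : ℕ) : List ℕ → List ℕ
  | [] => []
  | c :: l => (c + d) :: l

theorem Near.shiftHead {l l' : List ℕ} (h : Near l l') (d : ℕ) :
    Near (shiftHead d l) (shiftHead d l') := by
  have key : ∀ (l : List ℕ) (c : ℕ), Near (CoarseTW.shiftHead d l)
      (CoarseTW.shiftHead d (l ++ [c])) := by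
    rintro (_ | ⟨a, l⟩) c
    · exact near_nil_singleton _
    · exact .inr (.inl ⟨c, rfl⟩)
  obtain rfl | ⟨c, rfl⟩ | ⟨c, rfl⟩ := h
  · exact .refl _
  · exact key _ _
  · exact (key _ _).symm

theorem shiftHead_eq_nil {d : ℕ} {l : List ℕ} : shiftHead d l = [] ↔ l = [] := by
  cases l <;> simp [shiftHead]

variable {W : Type u} {H : SimpleGraph W} {K w : ℕ}

/-- `p` is a tree-partition of `H[U]` by words, of width at most `w`, with letters less than `w`. The
vertices of `S` are in the root bag, and the size of the root bag and the number of children of the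
root are less than `2 * S.card - 4 * K + 1`. -/
structure IsListPartition (H : SimpleGraph W) (K w : ℕ) (U S : Finset W) (p : W → List ℕ) :
    Prop where
  eq_nil : ∀ u ∈ S, p u = []
  near : ∀ u ∈ U, ∀ v ∈ U, H.Adj u v → Near (p u) (p v)
  card_le : ∀ l, (U.filter fun u => p u = l).card ≤ w
  root_card_le : (U.filter fun u => p u = []).card + 4 * K ≤ 2 * S.card
  letter_lt : ∀ u ∈ U, ∀ c ∈ p u, c < w
  head_lt : ∀ u ∈ U, ∀ c l, p u = c :: l → c + 4 * K < 2 * S.card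

variable [DecidableEq W]

/-- The base case: root bag `S` and one child `[0]` with the other vertices. Since `0 < K` and `4 *
K ≤ S.card`, the inequality `4 * K < 2 * S.card` leaves room for the letter `0`. -/
theorem isListPartition_of_card_sdiff_le {U S : Finset W} (hK : 0 < K)
    (hS : 4 * K ≤ S.card) (hSw : S.card ≤ w) (hU : (U \ S).card ≤ w) :
    IsListPartition H K w U S fun u => if u ∈ S then [] else [0] where
  eq_nil u hu := by simp [hu]
  near u _ v _ _ := by
    by_cases h : u ∈ S <;> by_cases h' : v ∈ S <;> simp only [h, h', if_true, if_false]
    · exact .refl _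
    · exact near_nil_singleton 0
    · exact (near_nil_singleton 0).symm
    · exact .refl _
  card_le l := by
    by_cases hl : l = []
    · refine (Finset.card_le_card fun u hu => ?_).trans hSw
      have := (Finset.mem_filter.1 hu).2
      by_contra h
      simp [h, hl] at this
    · refine (Finset.card_le_card fun u hu => ?_).trans hU
      rw [Finset.mem_filter] at hu
      refine Finset.mem_sdiff.2 ⟨hu.1, fun h => hl ?_⟩
      simpa [h] using hu.2.symm
  root_card_le := by
    have : (U.filter fun u => (if u ∈ S then [] else [0] : List ℕ) = []).card ≤ S.card :=
      Finset.card_le_card fun u hu => by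
        have := (Finset.mem_filter.1 hu).2
        by_contra h
        simp [h] at this
    omega
  letter_lt u _ c hc := by
    by_cases h : u ∈ S
    · simp [h] at hc
    · simp only [h, if_false, List.mem_singleton] at hc
      omega
  head_lt u _ c l h := by
    by_cases hu : u ∈ S
    · simp [hu] at h
    · simp only [hu, if_false, List.cons.injEq] at h
      omega

/-- Add a new root with bag `S` above a partition whose root bag contains the neighbours of `S`. -/
theorem IsListPartition.cons {U S S' : Finset W} {p : W → List ℕ}
    (hp : IsListPartition H K w (U \ S) S' p) (hK : 0 < K)
    (hS : 4 * K ≤ S.card) (hSw : S.card ≤ w)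
    (hN : ∀ u ∈ S, ∀ v ∈ U \ S, H.Adj u v → v ∈ S') :
    IsListPartition H K w U S fun u => if u ∈ S then [] else 0 :: p u where
  eq_nil u hu := by simp [hu]
  near u hu v hv huv := by
    by_cases h : u ∈ S <;> by_cases h' : v ∈ S <;> simp only [h, h', if_true, if_false]
    · exact .refl _
    · rw [hp.eq_nil v (hN u h v (by simp [hv, h']) huv)]
      exact near_nil_singleton 0
    · rw [hp.eq_nil u (hN v h' u (by simp [hu, h]) huv.symm)]
      exact (near_nil_singleton 0).symm
    · exact (hp.near u (by simp [hu, h]) v (by simp [hv, h']) huv).cons 0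
  card_le l := by
    cases l with
    | nil =>
      refine (Finset.card_le_card fun u hu => ?_).trans hSw
      have := (Finset.mem_filter.1 hu).2
      by_contra h
      simp [h] at this
    | cons a l =>
      refine (Finset.card_le_card fun u hu => ?_).trans (hp.card_le l)
      rw [Finset.mem_filter] at hu
      by_cases h : u ∈ S
      · simp [h] at hu
      · simp only [h, if_false, List.cons.injEq] at hu
        simp [hu, h]
  root_card_le := by
    have : (U.filter fun u => (if u ∈ S then [] else 0 :: p u : List ℕ) = []).card ≤ S.card :=
      Finset.card_le_card fun u hu => by
        have := (Finset.mem_filter.1 hu).2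
        by_contra h
        simp [h] at this
    omega
  letter_lt u hu c hc := by
    by_cases h : u ∈ S
    · simp [h] at hc
    · simp only [h, if_false, List.mem_cons] at hc
      obtain rfl | hc := hc
      · omega
      · exact hp.letter_lt u (by simp [hu, h]) c hc
  head_lt u _ c l h := by
    by_cases hu : u ∈ S
    · simp [hu] at h
    · simp only [hu, if_false, List.cons.injEq] at h
      omega

/-- Glue two partitions at their roots. -/
theorem IsListPartition.glue {U₁ U₂ S S₁ S₂ : Finset W} {p₁ p₂ : W → List ℕ}
    (h₁ : IsListPartition H K w U₁ S₁ p₁) (h₂ : IsListPartition H K w U₂ S₂ p₂)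
    (hS₁ : ∀ u ∈ S, u ∈ U₁ → u ∈ S₁) (hS₂ : ∀ u ∈ S, u ∉ U₁ → u ∈ S₂)
    (hinter : ∀ u ∈ U₁, u ∈ U₂ → u ∈ S₁ ∧ u ∈ S₂)
    (hedge : ∀ u ∈ U₁, ∀ v ∈ U₂, H.Adj u v → u ∈ U₂ ∨ v ∈ U₁)
    (hSw : 2 * S.card ≤ w + 4 * K) (hcard : S₁.card + S₂.card ≤ S.card + 2 * K) :
    IsListPartition H K w (U₁ ∪ U₂) S
      fun u => if u ∈ U₁ then p₁ u else shiftHead (2 * S₁.card - 4 * K) (p₂ u) := by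
  -- The children of the first root have letters less than `d`. Shifting those of the second root by
  -- `d` keeps the two families apart, so only the root bags merge.
  set d := 2 * S₁.card - 4 * K with hd
  set p : W → List ℕ := fun u => if u ∈ U₁ then p₁ u else shiftHead d (p₂ u) with hp
  have hpU₁ : ∀ u ∈ U₁, p u = p₁ u := fun u hu => by simp [hp, hu]
  -- On the overlap both partitions give the root, which the shift fixes.
  have hpU₂ : ∀ u ∈ U₂, p u = shiftHead d (p₂ u) := fun u hu => by
    by_cases h : u ∈ U₁
    · obtain ⟨h', h''⟩ := hinter u h hu
      rw [hpU₁ u h, h₁.eq_nil u h', h₂.eq_nil u h'']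
      rfl
    · simp [hp, h]
  have hK : 4 * K ≤ 2 * S₁.card := (Nat.le_add_left _ _).trans h₁.root_card_le
  have hhead : ∀ u ∈ U₁ ∪ U₂, ∀ c l, p u = c :: l →
      c + 4 * K < 2 * S.card ∧ ((u ∈ U₁ ∧ c < d ∧ p₁ u = c :: l) ∨
        (u ∈ U₂ ∧ d ≤ c ∧ p₂ u = (c - d) :: l)) := by
    intro u hu c l h
    have hr₂ := h₂.root_card_le
    by_cases hu₁ : u ∈ U₁
    · rw [hpU₁ u hu₁] at h
      have := h₁.head_lt u hu₁ c l h
      exact ⟨by omega, .inl ⟨hu₁, by omega, h⟩⟩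
    · have hu₂ : u ∈ U₂ := (Finset.mem_union.1 hu).resolve_left hu₁
      rw [hpU₂ u hu₂] at h
      cases h' : p₂ u with
      | nil => simp [h', shiftHead] at h
      | cons a l' =>
        simp only [h', shiftHead, List.cons.injEq] at h
        have := h₂.head_lt u hu₂ a l' h'
        refine ⟨by omega, .inr ⟨hu₂, by omega, ?_⟩⟩
        rw [List.cons.injEq]
        exact ⟨by omega, h.2⟩
  -- The bounds `2 * S₁.card - 4 * K` and `2 * S₂.card - 4 * K` add up to at most `2 * S.card - 4 *
  -- K`, because a split adds at most `2 * K` to the total size of the prescribed sets. This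
  -- additivity is why the invariant has this form.
  have hroot : ((U₁ ∪ U₂).filter fun u => p u = []).card + 4 * K ≤ 2 * S.card := by
    have : ((U₁ ∪ U₂).filter fun u => p u = []).card ≤ (U₁.filter fun u => p₁ u = []).card +
        (U₂.filter fun u => p₂ u = []).card := by
      refine (Finset.card_le_card fun u hu => ?_).trans (Finset.card_union_le _ _)
      simp only [Finset.mem_filter, Finset.mem_union] at hu ⊢
      obtain ⟨hu₁ | hu₂, h⟩ := hu
      · rw [hpU₁ u hu₁] at h
        exact .inl ⟨hu₁, h⟩
      · rw [hpU₂ u hu₂, shiftHead_eq_nil] at h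
        exact .inr ⟨hu₂, h⟩
    have := h₁.root_card_le
    have := h₂.root_card_le
    omega
  refine ⟨?_, ?_, ?_, hroot, ?_, fun u hu c l h => (hhead u hu c l h).1⟩
  · intro u hu
    by_cases h : u ∈ U₁
    · rw [hpU₁ u h, h₁.eq_nil u (hS₁ u hu h)]
    · simp [hp, h, h₂.eq_nil u (hS₂ u hu h), shiftHead]
  · intro u hu v hv huv
    have key : (u ∈ U₁ ∧ v ∈ U₁) ∨ (u ∈ U₂ ∧ v ∈ U₂) := by
      rw [Finset.mem_union] at hu hv
      have h := fun hu hv => hedge u hu v hv huv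
      have h' := fun hv hu => hedge v hv u hu huv.symm
      tauto
    obtain ⟨hu, hv⟩ | ⟨hu, hv⟩ := key
    · rw [hpU₁ u hu, hpU₁ v hv]
      exact h₁.near u hu v hv huv
    · rw [hpU₂ u hu, hpU₂ v hv]
      exact (h₂.near u hu v hv huv).shiftHead d
  · intro l
    cases l with
    | nil => omega
    | cons c l =>
      by_cases hc : c < d
      · refine (Finset.card_le_card fun u hu => ?_).trans (h₁.card_le (c :: l))
        rw [Finset.mem_filter] at hu
        obtain ⟨-, h | h⟩ := hhead u hu.1 c l hu.2
        · exact Finset.mem_filter.2 ⟨h.1, h.2.2⟩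
        · omega
      · refine (Finset.card_le_card fun u hu => ?_).trans (h₂.card_le ((c - d) :: l))
        rw [Finset.mem_filter] at hu
        obtain ⟨-, h | h⟩ := hhead u hu.1 c l hu.2
        · omega
        · exact Finset.mem_filter.2 ⟨h.1, h.2.2⟩
  · intro u hu c hc
    cases h : p u with
    | nil => simp [h] at hc
    | cons a l =>
      have h' := hhead u hu a l h
      rw [h, List.mem_cons] at hc
      obtain rfl | hc := hc
      · omega
      · obtain ⟨-, ⟨hu, -, h⟩ | ⟨hu, -, h⟩⟩ := h'
        · exact h₁.letter_lt u hu c (by simp [h, hc])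
        · exact h₂.letter_lt u hu c (by simp [h, hc])

/-- Every set `S` of vertices has a separator of size at most `K`, with at most two thirds of `S` on
each of its two sides. -/
def HasSeparators (H : SimpleGraph W) (K : ℕ) : Prop :=
  ∀ S : Finset W, ∃ X A B : Finset W, X.card ≤ K ∧ (∀ u, u ∈ A ∨ u ∈ X ∨ u ∈ B) ∧
    Disjoint A X ∧ Disjoint A B ∧ Disjoint X B ∧ (∀ u ∈ A, ∀ v ∈ B, ¬ H.Adj u v) ∧
    3 * (S ∩ A).card ≤ 2 * S.card ∧ 3 * (S ∩ B).card ≤ 2 * S.card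

/-- As `S.card ≤ β`, the measure `(β + 1) * U.card + S.card` is lexicographic: `U` first, then `S`.
When `S` has at most `12 * K` vertices, it becomes a bag of its own and its neighbours are
prescribed for the next root, so `U` shrinks. When `S` is larger, a separator splits the problem in
two; a side may still be all of `U`, but its prescribed set is smaller than `S`. -/
theorem exists_isListPartition {Δ β : ℕ} (hK : 0 < K) (hΔ : MaxDegreeLE H Δ)
    (hsep : HasSeparators H K) (hβ : 12 * K * Δ + 4 * K ≤ β) (n : ℕ) (U S : Finset W)
    (hSU : S ⊆ U) (hS : 4 * K ≤ S.card) (hSβ : S.card ≤ β)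
    (hn : (β + 1) * U.card + S.card ≤ n) :
    ∃ p, IsListPartition H K (2 * β) U S p := by
  induction n using Nat.strong_induction_on generalizing U S with
  | _ n ih =>
  by_cases hsmall : S.card ≤ 12 * K
  · by_cases hrest : (U \ S).card ≤ 4 * K
    · exact ⟨_, isListPartition_of_card_sdiff_le hK hS (by omega) (by omega)⟩
    · choose N hN hNadj using exists_finset_neighbors hΔ
      have hcard : ((S.biUnion N) ∩ (U \ S)).card ≤ 12 * K * Δ :=
        (Finset.card_le_card Finset.inter_subset_left).trans <|
          (Finset.card_biUnion_le_card_mul _ _ _ fun v _ => hN v).trans <|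
            Nat.mul_le_mul_right _ hsmall
      -- The neighbours of `S` are padded to at least `4 * K` vertices to restore the lower bound on
      -- the prescribed set.
      obtain ⟨S', hNS', hS'U, hS'⟩ := Finset.exists_subsuperset_card_eq
        (n := max ((S.biUnion N) ∩ (U \ S)).card (4 * K))
        (Finset.inter_subset_right (s₁ := S.biUnion N) (s₂ := U \ S)) (le_max_left _ _)
        (max_le (Finset.card_le_card Finset.inter_subset_right) (by omega))
      have hS'β : S'.card ≤ β := by omega
      have hlt : (β + 1) * (U \ S).card + S'.card < n := by
        have h1 : (U \ S).card + 1 ≤ U.card := by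
          have := Finset.card_sdiff_add_card_eq_card hSU
          omega
        have h2 := Nat.mul_le_mul_left (β + 1) h1
        rw [Nat.mul_add] at h2
        omega
      obtain ⟨p, hp⟩ := ih _ hlt (U \ S) S' hS'U (by omega) hS'β le_rfl
      refine ⟨_, hp.cons hK hS (by omega) fun u hu v hv huv => hNS' ?_⟩
      exact Finset.mem_inter.2 ⟨Finset.mem_biUnion.2 ⟨u, hu, hNadj u v huv⟩, hv⟩
  · obtain ⟨X, A, B, hX, hcov, hAX, hAB, hXB, hno, hSA, hSB⟩ := hsep S
    have hcardS : S.card = (S ∩ A).card + (S ∩ X).card + (S ∩ B).card := by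
      rw [← Finset.card_union_of_disjoint
        (hAX.mono Finset.inter_subset_right Finset.inter_subset_right),
        ← Finset.card_union_of_disjoint]
      · congr 1
        ext u
        have := hcov u
        simp only [Finset.mem_union, Finset.mem_inter]
        tauto
      · rw [Finset.disjoint_union_left]
        exact ⟨hAB.mono Finset.inter_subset_right Finset.inter_subset_right,
          hXB.mono Finset.inter_subset_right Finset.inter_subset_right⟩
    have hXU : (U ∩ X).card ≤ K := (Finset.card_le_card Finset.inter_subset_right).trans hX
    have hSX : (S ∩ X).card ≤ (U ∩ X).card :=
      Finset.card_le_card (Finset.inter_subset_inter_right hSU)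
    -- The new prescribed set has at most `2/3 * S.card + K` vertices, fewer than `S`. It has at
    -- least `S.card / 3` vertices, since the opposite side holds at most two thirds of `S`; the
    -- threshold `12 * K` makes this at least `4 * K`.
    have hside : ∀ C : Finset W, Disjoint C X → 3 * (S ∩ C).card ≤ 2 * S.card →
        S.card ≤ 3 * ((S ∩ C).card + (S ∩ X).card) →
        ((S ∩ C) ∪ (U ∩ X)).card = (S ∩ C).card + (U ∩ X).card ∧
        ∃ p, IsListPartition H K (2 * β) (U ∩ C ∪ U ∩ X) ((S ∩ C) ∪ (U ∩ X)) p := by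
      intro C hCX hC hC'
      have hcard : ((S ∩ C) ∪ (U ∩ X)).card = (S ∩ C).card + (U ∩ X).card :=
        Finset.card_union_of_disjoint
          (hCX.mono Finset.inter_subset_right Finset.inter_subset_right)
      refine ⟨hcard, ih _ ?_ (U ∩ C ∪ U ∩ X) ((S ∩ C) ∪ (U ∩ X)) ?_ ?_ ?_ le_rfl⟩
      · have : (U ∩ C ∪ U ∩ X).card ≤ U.card := Finset.card_le_card
          (Finset.union_subset Finset.inter_subset_left Finset.inter_subset_left)
        have := Nat.mul_le_mul_left (β + 1) this
        omega
      · exact Finset.union_subset_union_left (Finset.inter_subset_inter_right hSU)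
      · omega
      · omega
    obtain ⟨hcA, p₁, hp₁⟩ := hside A hAX hSA (by omega)
    obtain ⟨hcB, p₂, hp₂⟩ := hside B hXB.symm hSB (by omega)
    have hU : U = (U ∩ A ∪ U ∩ X) ∪ (U ∩ B ∪ U ∩ X) := by
      ext u
      have := hcov u
      simp only [Finset.mem_union, Finset.mem_inter]
      tauto
    have hdAB := Finset.disjoint_left.1 hAB
    have hglue := hp₁.glue (S := S) hp₂ ?_ ?_ ?_ ?_ (by omega) (by omega)
    · rw [← hU] at hglue
      exact ⟨_, hglue⟩
    · intro u hu h
      simp only [Finset.mem_union, Finset.mem_inter] at h ⊢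
      tauto
    · intro u hu h
      have := hcov u
      have := hSU hu
      simp only [Finset.mem_union, Finset.mem_inter] at h ⊢
      tauto
    · intro u h h'
      have := @hdAB u
      simp only [Finset.mem_union, Finset.mem_inter] at h h' ⊢
      tauto
    · intro u hu v hv huv
      simp only [Finset.mem_union, Finset.mem_inter] at hu hv ⊢
      have : ¬ (u ∈ A ∧ v ∈ B) := fun h => hno u h.1 v h.2 huv
      tauto

/-- A graph of bounded degree with small balanced separators has a partition by words of bounded
width with bounded letters. -/
theorem exists_word_partition [Fintype W] {Δ : ℕ} (hK : 0 < K) (hΔ : MaxDegreeLE H Δ)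
    (hsep : HasSeparators H K) :
    ∃ p : W → List ℕ, (∀ u v, H.Adj u v → Near (p u) (p v)) ∧
      (∀ l, (Finset.univ.filter fun u => p u = l).card ≤ 2 * (12 * K * Δ + 4 * K)) ∧
      ∀ u, ∀ c ∈ p u, c < 2 * (12 * K * Δ + 4 * K) := by
  by_cases hW : 4 * K ≤ (Finset.univ : Finset W).card
  · obtain ⟨S, -, hS⟩ := Finset.exists_subset_card_eq hW
    obtain ⟨p, hp⟩ := exists_isListPartition hK hΔ hsep le_rfl _ Finset.univ S
      (Finset.subset_univ S) hS.ge (by rw [hS]; exact Nat.le_add_left _ _) le_rfl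
    exact ⟨p, fun u v h => hp.near u (Finset.mem_univ _) v (Finset.mem_univ _) h, hp.card_le,
      fun u => hp.letter_lt u (Finset.mem_univ _)⟩
  -- With fewer than `4 * K` vertices, a single bag suffices.
  · refine ⟨fun _ => [], fun _ _ _ => .refl _, fun l => (Finset.card_filter_le _ _).trans ?_, by simp⟩
    omega

end ListPartition

/-! ### The finite tree of bounded words -/

section WordTree

/-- The words of length at most `L` with letters less than `D`. -/
def Word (D L : ℕ) : Type u := ULift.{u} {l : List ℕ // l.length ≤ L ∧ ∀ c ∈ l, c < D}

variable {D L : ℕ}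

/-- The underlying list of a word. -/
def Word.toList (x : Word.{u} D L) : List ℕ := x.down.1

theorem Word.ext {x y : Word.{u} D L} (h : x.toList = y.toList) : x = y :=
  ULift.ext _ _ (Subtype.ext h)

theorem Word.length_le (x : Word.{u} D L) : x.toList.length ≤ L := x.down.2.1

theorem Word.lt_of_mem (x : Word.{u} D L) : ∀ c ∈ x.toList, c < D := x.down.2.2

/-- The word with a given underlying list. -/
def Word.mk (l : List ℕ) (h : l.length ≤ L) (h' : ∀ c ∈ l, c < D) : Word.{u} D L := ⟨⟨l, h, h'⟩⟩

@[simp]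
theorem Word.toList_mk (l : List ℕ) (h : l.length ≤ L) (h' : ∀ c ∈ l, c < D) :
    (Word.mk.{u} l h h').toList = l := rfl

instance : Finite (Word.{u} D L) := by
  have := (List.finite_length_le (Fin D) L).to_subtype
  let f (x : Word.{u} D L) : {l : List (Fin D) | l.length ≤ L} :=
    ⟨x.toList.pmap (fun c h => ⟨c, h⟩) x.lt_of_mem, by simpa using x.length_le⟩
  refine Finite.of_injective f fun x y h => ?_
  have := congrArg (List.map Fin.val) (congrArg Subtype.val h)
  simp only [f, List.map_pmap, List.pmap_eq_map, List.map_id'] at this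
  exact Word.ext this

/-- The tree of words. -/
def wordTree (D L : ℕ) : SimpleGraph (Word.{u} D L) where
  Adj x y := x ≠ y ∧ Near x.toList y.toList
  symm := ⟨fun _ _ h => ⟨h.1.symm, h.2.symm⟩⟩
  loopless := ⟨fun _ h => h.1 rfl⟩

theorem wordTree_adj_of_append {x y : Word.{u} D L} {c : ℕ} (h : y.toList = x.toList ++ [c]) :
    (wordTree D L).Adj x y :=
  ⟨by rintro rfl; simp at h, .inr (.inl ⟨c, h⟩)⟩

theorem wordTree_adj_iff {x y : Word.{u} D L} : (wordTree D L).Adj x y ↔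
    (∃ c, y.toList = x.toList ++ [c]) ∨ ∃ c, x.toList = y.toList ++ [c] := by
  constructor
  · rintro ⟨hne, h | h⟩
    · exact absurd (Word.ext h) hne
    · exact h
  · rintro (⟨c, h⟩ | ⟨c, h⟩)
    · exact wordTree_adj_of_append h
    · exact (wordTree_adj_of_append h).symm

theorem wordTree_connected : (wordTree.{u} D L).Connected := by
  let root : Word.{u} D L := .mk [] (by simp) (by simp)
  have key : ∀ (n : ℕ) (x : Word.{u} D L), x.toList.length = n →
      (wordTree D L).Reachable root x := by
    intro n
    induction n with
    | zero =>
      intro x hx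
      have : root = x := Word.ext (List.eq_nil_of_length_eq_zero hx).symm
      rw [this]
    | succ n ih =>
      intro x hx
      have hne : x.toList ≠ [] := by rintro h; simp [h] at hx
      let y : Word.{u} D L := .mk x.toList.dropLast (by have := x.length_le; simp; omega)
        fun c hc => x.lt_of_mem c (List.mem_of_mem_dropLast hc)
      refine (ih y (by simp [y, hx])).trans (SimpleGraph.Adj.reachable ?_)
      exact wordTree_adj_of_append (c := x.toList.getLast hne)
        (List.dropLast_append_getLast hne).symm
  have : Nonempty (Word.{u} D L) := ⟨root⟩
  exact ⟨fun x y => (key _ x rfl).symm.trans (key _ y rfl)⟩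

/-- Every edge from `x` to a child `y` is a bridge: once it is deleted, a walk from `y` can never
leave the words with prefix `y`, and `x` is shorter than `y`. -/
theorem wordTree_isTree : (wordTree.{u} D L).IsTree := by
  refine ⟨wordTree_connected, SimpleGraph.isAcyclic_iff_forall_adj_isBridge.2 ?_⟩
  have key : ∀ x y : Word.{u} D L, ∀ c, y.toList = x.toList ++ [c] →
      ¬ ((wordTree D L).deleteEdges {s(x, y)}).Reachable y x := by
    rintro x y c hxy ⟨p⟩
    have hwalk : ∀ a b : Word.{u} D L, ((wordTree D L).deleteEdges {s(x, y)}).Walk a b →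
        y.toList <+: a.toList → y.toList <+: b.toList := by
      intro a b p
      induction p with
      | nil => exact id
      | @cons a b _ h _ ih =>
        intro ha
        refine ih ?_
        rw [SimpleGraph.deleteEdges_adj, wordTree_adj_iff] at h
        obtain ⟨⟨d, h⟩ | ⟨d, h⟩, hne⟩ := h
        · rw [h]
          exact ha.trans (List.prefix_append _ _)
        · rw [h, List.prefix_concat_iff] at ha
          obtain ha | ha := ha
          · exfalso
            have hya : y = a := Word.ext (ha.trans h.symm)
            rw [hxy] at ha
            have hxb : x = b := Word.ext (List.append_inj_left' ha rfl)
            rw [hya, hxb, Sym2.eq_swap] at hne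
            exact hne rfl
          · exact ha
    have := (hwalk _ _ p (List.prefix_refl _)).length_le
    rw [hxy] at this
    simp at this
  intro x y hxy
  rw [SimpleGraph.isBridge_iff]
  obtain ⟨c, h⟩ | ⟨c, h⟩ := wordTree_adj_iff.1 hxy
  · exact fun h' => key x y c h h'.symm
  · rw [Sym2.eq_swap]
    exact key y x c h

theorem maxDegreeLE_wordTree : MaxDegreeLE (wordTree.{u} D L) (D + 1) := by
  classical
  intro x
  let A : Finset (List ℕ) := insert x.toList.dropLast
    ((Finset.range D).image fun c => x.toList ++ [c])
  have hmaps : Set.MapsTo Word.toList ((wordTree D L).neighborSet x) (A : Set (List ℕ)) := by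
    intro y hy
    obtain ⟨c, h⟩ | ⟨c, h⟩ := wordTree_adj_iff.1 hy
    · refine Finset.mem_insert_of_mem (Finset.mem_image.2 ⟨c, ?_, h.symm⟩)
      exact Finset.mem_range.2 (y.lt_of_mem c (by simp [h]))
    · refine Finset.mem_insert.2 (.inl ?_)
      simp [h]
  refine (Set.encard_le_encard_of_injOn hmaps fun _ _ _ _ h => Word.ext h).trans ?_
  rw [Set.encard_coe_eq_coe_finsetCard]
  have : A.card ≤ D + 1 := (Finset.card_insert_le _ _).trans
    (Nat.succ_le_succ (Finset.card_image_le.trans (by simp)))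
  exact_mod_cast this

variable {W : Type u} {H : SimpleGraph W}

/-- The width of the tree-partitions constructed from separators. -/
def partitionWidth (K Δ : ℕ) : ℕ := 2 * (12 * K * Δ + 4 * K)

/-- A graph of bounded degree with small balanced separators has a tree-partition of bounded width
and degree. -/
theorem exists_tree_map [Fintype W] [DecidableEq W] {K Δ : ℕ} (hK : 0 < K) (hΔ : MaxDegreeLE H Δ)
    (hsep : HasSeparators H K) :
    ∃ (T : Type u) (_ : Finite T) (G : SimpleGraph T) (q : W → T), G.IsTree ∧
      MaxDegreeLE G (partitionWidth K Δ + 1) ∧ (∀ u v, H.Adj u v → q u = q v ∨ G.Adj (q u) (q v)) ∧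
      ∀ x, (q ⁻¹' {x}).encard ≤ partitionWidth K Δ := by
  obtain ⟨p, hadj, hcard, hlt⟩ := exists_word_partition hK hΔ hsep
  -- Letters below the width bound the degree of the tree; capping lengths at the longest word in
  -- use makes it finite.
  let q : W → Word.{u} (partitionWidth K Δ) (Finset.univ.sup fun u => (p u).length) := fun u =>
    .mk (p u) (Finset.le_sup (f := fun u => (p u).length) (Finset.mem_univ u)) (hlt u)
  refine ⟨_, inferInstance, wordTree _ _, q, wordTree_isTree, maxDegreeLE_wordTree,
    fun u v huv => ?_, fun x => ?_⟩
  · by_cases h : q u = q v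
    · exact .inl h
    · exact .inr ⟨h, hadj u v huv⟩
  · refine le_trans ?_ (Nat.cast_le.2 (hcard x.toList))
    rw [← Set.encard_coe_eq_coe_finsetCard]
    refine Set.encard_le_encard fun u hu => ?_
    rw [Finset.coe_filter]
    exact ⟨Finset.mem_univ _, congrArg Word.toList hu⟩

end WordTree

/-! ### Grouping the components outside a separator into two sides -/

section Sides

variable {V : Type u} [Fintype V] {G : SimpleGraph V}

/-- The components of the complement of a balanced separator can be grouped into two sides, each
with at most two thirds of the total weight. -/
theorem IsBalancedSeparator.exists_sides {μ : V → ℝ≥0} {X : Set V}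
    (h : IsBalancedSeparator G μ X) :
    ∃ A B : Set V, Disjoint A X ∧ Disjoint A B ∧ Disjoint X B ∧ (∀ u, u ∈ A ∨ u ∈ X ∨ u ∈ B) ∧
      (∀ u ∈ A, ∀ v ∈ B, ¬ G.Adj u v) ∧ 3 * weightOf μ A ≤ 2 * weightOf μ Set.univ ∧
      3 * weightOf μ B ≤ 2 * weightOf μ Set.univ := by
  classical
  set s := weightOf μ Set.univ
  -- Closed sets are the unions of components of `G - X`.
  let Closed : Set V → Prop := fun A => A ⊆ Xᶜ ∧ ∀ u ∈ A, ∀ v ∉ X, G.Adj u v → v ∈ A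
  suffices hmain : ∃ A, Closed A ∧ 3 * weightOf μ A ≤ 2 * s ∧ 3 * weightOf μ (X ∪ A)ᶜ ≤ 2 * s by
    obtain ⟨A, hA, hwA, hwB⟩ := hmain
    refine ⟨A, (X ∪ A)ᶜ, ?_, ?_, ?_, ?_, ?_, hwA, hwB⟩
    · exact Set.disjoint_left.2 fun u hu => hA.1 hu
    · exact Set.disjoint_left.2 fun u hu h => h (.inr hu)
    · exact Set.disjoint_left.2 fun u hu h => h (.inl hu)
    · intro u
      simp only [Set.mem_compl_iff, Set.mem_union]
      tauto
    · exact fun u hu v hv huv => hv (.inr (hA.2 u hu v (fun h => hv (.inl h)) huv))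
  have hempty : Closed ∅ ∧ 3 * weightOf μ ∅ ≤ 2 * s := by simp [Closed, weightOf]
  -- Take a maximal union `A` of components with at most two thirds of the weight. Let `C` be a
  -- component outside `A`, if there is one. If `C` has at least a third of the weight, `C` alone is
  -- a good side. Otherwise `A ∪ C` exceeds two thirds by maximality, so `A` has more than a third
  -- and its complement less than two thirds.
  obtain ⟨A, hA, hmax⟩ := (Set.toFinite {A | Closed A ∧ 3 * weightOf μ A ≤ 2 * s}).exists_maximal
    ⟨∅, hempty⟩
  by_cases hcov : (X ∪ A)ᶜ = ∅
  · exact ⟨A, hA.1, hA.2, by rw [hcov]; simp [weightOf]⟩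
  obtain ⟨v, hv⟩ := Set.nonempty_iff_ne_empty.2 hcov
  have hvX : v ∉ X := fun h => hv (.inl h)
  let c := (G.induce Xᶜ).connectedComponentMk ⟨v, hvX⟩
  let C : Set V := Subtype.val '' c.supp
  have hvC : v ∈ C := ⟨⟨v, hvX⟩, rfl, rfl⟩
  have hC : Closed C := by
    constructor
    · rintro _ ⟨u, -, rfl⟩
      exact u.2
    · rintro _ ⟨u, hu, rfl⟩ w hw huw
      refine ⟨⟨w, hw⟩, ?_, rfl⟩
      rw [SimpleGraph.ConnectedComponent.mem_supp_iff] at hu ⊢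
      rw [← hu, SimpleGraph.ConnectedComponent.eq]
      have hadj : (G.induce Xᶜ).Adj u ⟨w, hw⟩ := huw
      exact hadj.symm.reachable
  have hwC : weightOf μ C ≤ s / 2 := h c
  have hwC' : 2 * weightOf μ C ≤ s := by
    rw [le_div_iff₀ (by norm_num)] at hwC
    rwa [mul_comm]
  have hcompl : ∀ B : Set V, weightOf μ B + weightOf μ (X ∪ B)ᶜ ≤ s := fun B => by
    have hd : Disjoint B (X ∪ B)ᶜ := Set.disjoint_left.2 fun u hu h => h (.inr hu)
    rw [← weightOf_union hd]
    exact weightOf_mono (Set.subset_univ _)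
  by_cases hlarge : s ≤ 3 * weightOf μ C
  · refine ⟨C, hC, ?_, ?_⟩
    · have := mul_le_mul_of_nonneg_left hwC' (by norm_num : (0 : ℝ≥0) ≤ 3)
      have h0 : (0 : ℝ≥0) ≤ s := zero_le
      rw [← NNReal.coe_le_coe] at *
      push_cast at *
      linarith
    · have := hcompl C
      rw [← NNReal.coe_le_coe] at *
      push_cast at *
      linarith
  · have hAC : Closed (A ∪ C) := by
      refine ⟨Set.union_subset hA.1.1 hC.1, ?_⟩
      rintro u (hu | hu) w hw huw
      · exact .inl (hA.1.2 u hu w hw huw)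
      · exact .inr (hC.2 u hu w hw huw)
    have hbig : ¬ 3 * weightOf μ (A ∪ C) ≤ 2 * s := fun h' =>
      hv (.inr (hmax ⟨hAC, h'⟩ Set.subset_union_left (.inr hvC)))
    have hdisj : Disjoint A C := by
      refine Set.disjoint_left.2 ?_
      rintro _ hu ⟨u, hu', rfl⟩
      obtain ⟨p⟩ := SimpleGraph.ConnectedComponent.exact hu'
      have hwalk : ∀ a b : (Xᶜ : Set V), (G.induce Xᶜ).Walk a b → a.1 ∈ A → b.1 ∈ A := by
        intro a b p
        induction p with
        | nil => exact id
        | @cons a b _ h _ ih => exact fun ha => ih (hA.1.2 a ha b b.2 h)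
      exact hv (.inr (hwalk _ _ p hu))
    rw [weightOf_union hdisj] at hbig
    refine ⟨A, hA.1, hA.2, ?_⟩
    have := hcompl A
    rw [← NNReal.coe_le_coe] at *
    push_cast at *
    linarith

theorem weightOf_sum_single {W : Type*} (ι : W → V) (S : Finset W) (A : Set V) [DecidableEq V]
    [DecidablePred fun n => ι n ∈ A] :
    weightOf (fun v => ∑ n ∈ S, if ι n = v then 1 else 0) A =
      (S.filter fun n => ι n ∈ A).card := by
  classical
  calc weightOf (fun v => ∑ n ∈ S, if ι n = v then 1 else 0) A
      = ∑ v, ∑ n ∈ S, if ι n = v ∧ v ∈ A then 1 else 0 := by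
        refine Finset.sum_congr rfl fun v _ => ?_
        by_cases hv : v ∈ A <;> simp [hv]
    _ = ∑ n ∈ S, ∑ v, if ι n = v ∧ v ∈ A then 1 else 0 := Finset.sum_comm
    _ = ∑ n ∈ S, if ι n ∈ A then 1 else 0 := by
        refine Finset.sum_congr rfl fun n _ => ?_
        rw [Finset.sum_eq_single (ι n)]
        · simp
        · intro v _ hv
          simp [hv.symm]
        · simp
    _ = _ := by simp

end Sides

/-! ### Nets at scale `r` and their separators -/

section Net

variable {V : Type u}

/-- There is a set of vertices with pairwise distances more than `r`, such that every vertex is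
within distance `r` of it. -/
theorem exists_net [Finite V] (G : SimpleGraph V) (r : ℕ) :
    ∃ N : Set V, (∀ a ∈ N, ∀ b ∈ N, dist G a b ≤ r → a = b) ∧ ∀ v, ∃ a ∈ N, dist G v a ≤ r := by
  obtain ⟨N, hN, hmax⟩ := (Set.toFinite
    {N : Set V | ∀ a ∈ N, ∀ b ∈ N, dist G a b ≤ r → a = b}).exists_maximal ⟨∅, by simp⟩
  refine ⟨N, hN, fun v => ?_⟩
  by_contra! hv
  have : insert v N ≤ N := by
    refine hmax ?_ (Set.subset_insert v N)
    rintro a (rfl | ha) b (rfl | hb) hab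
    · rfl
    · exact absurd hab (hv b hb).not_ge
    · rw [dist_comm] at hab
      exact absurd hab (hv a ha).not_ge
    · exact hN a ha b hb hab
  have hvN := this (Set.mem_insert v N)
  have h1 := hv v hvN
  rw [dist_self] at h1
  exact not_lt_bot h1

/-- The graph on `N` in which two points are adjacent if their distance is at most `3 * r`. -/
def netGraph (G : SimpleGraph V) (r : ℕ) (N : Set V) : SimpleGraph N where
  Adj a b := a ≠ b ∧ dist G a b ≤ (3 * r : ℕ)
  symm := ⟨fun a b h => ⟨h.1.symm, by rw [dist_comm]; exact h.2⟩⟩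
  loopless := ⟨fun _ h => h.1 rfl⟩

variable {G : SimpleGraph V} {r m : ℕ} {N : Set V}

/-- Since `4r = 2 ^ 3 * (r / 2)`, three doublings reach the radius `r / 2` at which a ball contains
at most one net point. The radius `4r` is the one needed for separators, and it also covers the `3r`
of adjacency. -/
theorem ncard_net_inter_ball_le (hG : DoublingDimLE G m)
    (hN : ∀ a ∈ N, ∀ b ∈ N, dist G a b ≤ r → a = b) (u : V) :
    (N ∩ ball G u (4 * r)).ncard ≤ 8 ^ m := by
  have h := (hG.ncard_separated_le (r := r) (A := N ∩ ball G u (4 * r))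
    (fun a ha b hb hab => hN a ha.1 b hb.1 (by simpa using hab)) u 3 ?_).2
  · rwa [← pow_mul, mul_comm m 3, pow_mul] at h
  · have h4 : (4 * r : ℝ≥0) = 2 ^ 3 * (r / 2) := by ring
    exact fun v hv => h4 ▸ hv.2

theorem maxDegreeLE_netGraph [Finite V] (hG : DoublingDimLE G m)
    (hN : ∀ a ∈ N, ∀ b ∈ N, dist G a b ≤ r → a = b) : MaxDegreeLE (netGraph G r N) (8 ^ m) := by
  intro a
  have hmaps : Set.MapsTo Subtype.val ((netGraph G r N).neighborSet a)
      (N ∩ ball G a (4 * r)) := by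
    rintro b ⟨-, hb⟩
    refine ⟨b.2, hb.trans ?_⟩
    rw [← ENNReal.coe_natCast, ENNReal.coe_le_coe]
    push_cast
    gcongr
    norm_num
  refine (Set.encard_le_encard_of_injOn hmaps Subtype.val_injective.injOn).trans ?_
  rw [← (Set.toFinite _).cast_ncard_eq]
  exact_mod_cast ncard_net_inter_ball_le hG hN a

/-- The bound on the size of separators in the net. -/
def netSeparatorBound (m k : ℕ) : ℕ := k * 8 ^ m + 1

/-- Let `X` be a separator of `G` covered by `r`-balls around `Z`, and let `Y` be the net points
within `4r` of `Z`. An edge of the net is a walk of length at most `3r` in `G`. If it joins the two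
sides of `X`, it meets `X`, so its end is within `3r + r` of `Z` and belongs to `Y`. -/
theorem hasSeparators_netGraph [Fintype V] [DecidableEq N] {k : ℕ} (hG : DoublingDimLE G m)
    (hN : ∀ a ∈ N, ∀ b ∈ N, dist G a b ≤ r → a = b) (hsep : BalancedSeparatorNumberLE G r k) :
    HasSeparators (netGraph G r N) (netSeparatorBound m k) := by
  classical
  intro S
  -- Unit weight on the points of `S` turns weights into cardinalities.
  obtain ⟨X, ⟨Z, hZ, hXZ⟩, hX⟩ := hsep fun v => ∑ n ∈ S, if n.1 = v then 1 else 0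
  obtain ⟨A, B, hAX, hAB, hXB, hcov, hno, hwA, hwB⟩ := hX.exists_sides
  rw [weightOf_sum_single, weightOf_sum_single] at hwA hwB
  have hXZ' : ∀ x ∈ X, ∃ z ∈ Z, dist G z x ≤ r := fun x hx => by
    simpa [mem_ball] using hXZ hx
  let Y : Finset N := Finset.univ.filter fun n => ∃ z ∈ Z, dist G z n ≤ (4 * r : ℝ≥0)
  have hle : (r : ℝ≥0∞) ≤ (4 * r : ℝ≥0) := by
    rw [← ENNReal.coe_natCast, ENNReal.coe_le_coe]
    exact le_mul_of_one_le_left (by simp) (by norm_num)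
  have hXY : ∀ n : N, n.1 ∈ X → n ∈ Y := fun n hn => by
    obtain ⟨z, hz, h⟩ := hXZ' n hn
    exact Finset.mem_filter.2 ⟨Finset.mem_univ _, z, hz, h.trans hle⟩
  refine ⟨Y, Finset.univ.filter fun n => n.1 ∈ A ∧ n ∉ Y,
    Finset.univ.filter fun n => n.1 ∈ B ∧ n ∉ Y, ?_, ?_, ?_, ?_, ?_, ?_, ?_, ?_⟩
  · have hY : Y ⊆ Z.biUnion fun z => Finset.univ.filter fun n : N =>
        dist G z n ≤ (4 * r : ℝ≥0) := by
      intro n hn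
      obtain ⟨z, hz, h⟩ := (Finset.mem_filter.1 hn).2
      exact Finset.mem_biUnion.2 ⟨z, hz, Finset.mem_filter.2 ⟨Finset.mem_univ _, h⟩⟩
    refine ((Finset.card_le_card hY).trans
      ((Finset.card_biUnion_le_card_mul _ _ (8 ^ m) fun z _ => ?_).trans
        (Nat.mul_le_mul_right _ hZ))).trans (Nat.le_succ _)
    refine le_trans ?_ (ncard_net_inter_ball_le hG hN z)
    rw [← Set.ncard_coe_finset]
    refine Set.ncard_le_ncard_of_injOn Subtype.val (fun n hn => ?_)
      Subtype.val_injective.injOn (Set.toFinite _)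
    exact ⟨n.2, (Finset.mem_filter.1 hn).2⟩
  · intro n
    have := hcov n
    have := hXY n
    simp only [Finset.mem_filter, Finset.mem_univ, true_and]
    tauto
  · exact Finset.disjoint_left.2 fun n hn => (Finset.mem_filter.1 hn).2.2
  · refine Finset.disjoint_left.2 fun n hn hn' => ?_
    exact Set.disjoint_left.1 hAB (Finset.mem_filter.1 hn).2.1 (Finset.mem_filter.1 hn').2.1
  · exact Finset.disjoint_left.2 fun n hn hn' => (Finset.mem_filter.1 hn').2.2 hn
  · intro a ha b hb hab
    rw [Finset.mem_filter] at ha hb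
    obtain ⟨p, hp⟩ := exists_walk_of_dist_le hab.2
    have hmeet : ∃ x ∈ p.support, x ∈ X := by
      by_contra! hcon
      have hwalk : ∀ (a b : V) (p : G.Walk a b), (∀ x ∈ p.support, x ∉ X) → a ∈ A → b ∈ A := by
        intro a b p
        induction p with
        | nil => exact fun _ => id
        | @cons a b _ h p ih =>
          intro hp ha
          refine ih (fun x hx => hp x (by simp [hx])) ?_
          exact ((hcov b).resolve_right fun h' =>
            h'.elim (hp b (by simp)) fun hb => hno a ha b hb h)
      exact Set.disjoint_left.1 hAB (hwalk _ _ p hcon ha.2.1) hb.2.1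
    obtain ⟨x, hxp, hxX⟩ := hmeet
    obtain ⟨z, hz, hzx⟩ := hXZ' x hxX
    refine ha.2.2 (Finset.mem_filter.2 ⟨Finset.mem_univ _, z, hz, ?_⟩)
    calc dist G z a ≤ dist G z x + dist G x a := dist_triangle _ _ _
      _ ≤ r + (3 * r : ℕ) := by
          gcongr
          refine (dist_le_length (p.takeUntil x hxp).reverse).trans ?_
          rw [SimpleGraph.Walk.length_reverse]
          exact_mod_cast (p.length_takeUntil_le_length hxp).trans hp
      _ = (4 * r : ℝ≥0) := by push_cast; ring
  · refine le_trans (b := 3 * (S.filter fun n => n.1 ∈ A).card)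
      (Nat.mul_le_mul_left 3 (Finset.card_le_card fun n hn => ?_)) ?_
    · simp only [Finset.mem_inter, Finset.mem_filter] at hn ⊢
      exact ⟨hn.1, hn.2.2.1⟩
    · simpa using (by exact_mod_cast hwA :
        3 * (S.filter fun n => n.1 ∈ A).card ≤ 2 * (S.filter fun n => n.1 ∈ Set.univ).card)
  · refine le_trans (b := 3 * (S.filter fun n => n.1 ∈ B).card)
      (Nat.mul_le_mul_left 3 (Finset.card_le_card fun n hn => ?_)) ?_
    · simp only [Finset.mem_inter, Finset.mem_filter] at hn ⊢
      exact ⟨hn.1, hn.2.2.1⟩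
    · simpa using (by exact_mod_cast hwB :
        3 * (S.filter fun n => n.1 ∈ B).card ≤ 2 * (S.filter fun n => n.1 ∈ Set.univ).card)

end Net

/-! ### From separators of the net back to the graph -/

section FromSeparator

variable {V : Type u} {G : SimpleGraph V} {r : ℕ} {N : Set V}

/-- Moving both ends to the net adds at most `2r` to their distance, which is why adjacency in the
net allows `3r`. -/
theorem netGraph_near {π : V → N} (hπ : ∀ v, dist G v (π v) ≤ r) {u v : V}
    (h : dist G u v ≤ r) : π u = π v ∨ (netGraph G r N).Adj (π u) (π v) := by
  by_cases hne : π u = π v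
  · exact .inl hne
  · refine .inr ⟨hne, ?_⟩
    calc dist G (π u) (π v) ≤ dist G (π u) u + (dist G u v + dist G v (π v)) :=
          (dist_triangle _ u _).trans (add_le_add_right (dist_triangle _ _ _) _)
      _ ≤ r + (r + r) := by
          gcongr
          · rw [dist_comm]; exact hπ u
          · exact hπ v
      _ = (3 * r : ℕ) := by push_cast; ring

/-- Cut the walk into `q` pieces of length at most `r`; the ends of each piece project to equal or
adjacent net points. -/
theorem exists_netGraph_walk {π : V → N} (hπ : ∀ v, dist G v (π v) ≤ r) (q : ℕ) {u v : V}
    (p : G.Walk u v) (hp : p.length ≤ q * r) :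
    ∃ p' : (netGraph G r N).Walk (π u) (π v), p'.length ≤ q := by
  induction q generalizing u with
  | zero =>
    obtain rfl := SimpleGraph.Walk.eq_of_length_eq_zero (p := p) (by simpa using hp)
    exact ⟨.nil, le_rfl⟩
  | succ q ih =>
    obtain ⟨p', hp'⟩ := ih (p.drop r) (by
      rw [SimpleGraph.Walk.drop_length]
      rw [Nat.succ_mul] at hp
      omega)
    have h : dist G u (p.getVert r) ≤ r := (dist_le_length (p.take r)).trans (by
      rw [SimpleGraph.Walk.take_length]
      exact_mod_cast min_le_left _ _)
    obtain h | h := netGraph_near hπ h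
    · exact ⟨p'.copy h.symm rfl, by simpa using hp'.trans (Nat.le_succ q)⟩
    · exact ⟨.cons h p', by simpa using hp'⟩

theorem dist_le_netGraph_length {a b : N} (p : (netGraph G r N).Walk a b) :
    dist G a b ≤ (p.length * (3 * r) : ℕ) := by
  induction p with
  | nil => simp [dist_self]
  | @cons a b c h p ih =>
    calc dist G a c ≤ dist G a b + dist G b c := dist_triangle _ _ _
      _ ≤ (3 * r : ℕ) + (p.length * (3 * r) : ℕ) := add_le_add h.2 ih
      _ = _ := by
          rw [SimpleGraph.Walk.length_cons]
          push_cast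
          ring

/-- The net with edges of weight `3 * r`. -/
noncomputable def weightedNetGraph [Fintype V] (G : SimpleGraph V) (r : ℕ) (N : Set V) :
    EdgeWeightedGraph.{u} where
  V := N
  fin := Fintype.ofFinite N
  graph := netGraph G r N
  weight _ := 3 * r

theorem weightedNetGraph_length [Fintype V] {a b : N} (p : (netGraph G r N).Walk a b) :
    (weightedNetGraph G r N).length p = (p.length * (3 * r) : ℕ) := by
  simp [EdgeWeightedGraph.length, weightedNetGraph]

theorem weightedNetGraph_dist [Fintype V] (a b : N) : (weightedNetGraph G r N).dist a b =
    ⨅ p : (netGraph G r N).Walk a b, ((p.length * (3 * r) : ℕ) : ℝ≥0∞) := by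
  refine iInf_congr fun p => ?_
  rw [weightedNetGraph_length p]
  rfl

/-- For the upper bound, a walk of length `d` projects to at most `d / r + 1` net edges (with
integer division), of total weight at most `3d + 3r`. For the lower bound, a net edge of weight `3r`
spans a distance of at most `3r` in `G`, so passing to the net loses only the `2r` spent at the two
ends. -/
theorem isQuasiIsometry_netGraph [Fintype V] (hr : 0 < r) {π : V → N}
    (hπ : ∀ v, dist G v (π v) ≤ r) (hπN : ∀ n : N, π n = n) :
    IsQuasiIsometry (dist G) (weightedNetGraph G r N).dist 3 (3 * r) π := by
  refine ⟨fun u v => ⟨?_, ?_⟩, fun w => ⟨w.1, ?_⟩⟩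
  · refine (ENNReal.div_le_of_le_mul ?_ : dist G u v / (3 : ℝ≥0) ≤ _)
    rw [weightedNetGraph_dist, ENNReal.iInf_add, ENNReal.iInf_mul_of_ne (by simp) (by simp)]
    refine le_iInf fun p => ?_
    calc dist G u v ≤ dist G u (π u) + (dist G (π u) (π v) + dist G (π v) v) :=
          (dist_triangle _ (π u).1 _).trans (add_le_add_right (dist_triangle _ _ _) _)
      _ ≤ r + ((p.length * (3 * r) : ℕ) + r) := by
          gcongr
          · exact hπ u
          · exact dist_le_netGraph_length p
          · rw [dist_comm]; exact hπ v
      _ = (r + (p.length * (3 * r) + r) : ℕ) := by push_cast; rfl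
      _ ≤ ((p.length * (3 * r) + 3 * r) * 3 : ℕ) := by
          norm_cast
          generalize p.length * (3 * r) = x
          omega
      _ = _ := by push_cast; rfl
  · by_cases htop : dist G u v = ⊤
    · simp [htop]
    · obtain ⟨p, hp⟩ := exists_walk_of_dist_ne_top htop
      obtain ⟨p', hp'⟩ := exists_netGraph_walk hπ (p.length / r + 1) p
        (by rw [mul_comm]; exact (Nat.lt_mul_div_succ _ hr).le)
      rw [weightedNetGraph_dist, ← hp]
      refine (iInf_le _ p').trans ?_
      have h : p'.length * (3 * r) ≤ 3 * p.length + 3 * r :=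
        calc p'.length * (3 * r) ≤ (p.length / r + 1) * (3 * r) := Nat.mul_le_mul_right _ hp'
          _ = 3 * (p.length / r * r) + 3 * r := by ring
          _ ≤ _ := by gcongr; exact Nat.div_mul_le_self _ _
      calc ((p'.length * (3 * r) : ℕ) : ℝ≥0∞) ≤ ((3 * p.length + 3 * r : ℕ) : ℝ≥0∞) := by
            exact_mod_cast h
        _ = _ := by push_cast; rfl
  · rw [hπN w]
    exact (iInf_le _ .nil).trans (by simp [EdgeWeightedGraph.length])

/-- The width of the tree-partition of a net constructed from separators. -/
def netPartitionWidth (m k : ℕ) : ℕ := partitionWidth (netSeparatorBound m k) (8 ^ m)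

theorem SeparatorCond.exists_tree_map {G : FiniteGraph.{u}} {k m : ℕ}
    (h : SeparatorCond r k G) (hG : DoublingDimLE G.graph m) :
    ∃ (N : Set G.V) (π : G.V → N), (∀ v, dist G.graph v (π v) ≤ r) ∧ (∀ n : N, π n = n) ∧
      MaxDegreeLE (netGraph G.graph r N) (8 ^ m) ∧
      ∃ (T : Type u) (_ : Finite T) (F : SimpleGraph T) (q : N → T), F.IsTree ∧
        MaxDegreeLE F (netPartitionWidth m k + 1) ∧
        (∀ a b, (netGraph G.graph r N).Adj a b → q a = q b ∨ F.Adj (q a) (q b)) ∧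
        ∀ x, (q ⁻¹' {x}).encard ≤ netPartitionWidth m k := by
  classical
  obtain ⟨N, hN, hcov⟩ := exists_net G.graph r
  choose π hπN hπ using hcov
  refine ⟨N, fun v => ⟨π v, hπN v⟩, hπ, fun n => Subtype.ext ?_, maxDegreeLE_netGraph hG hN,
    -- The `+ 1` in `netSeparatorBound` provides the positivity required here.
    CoarseTW.exists_tree_map (Nat.succ_pos _) (maxDegreeLE_netGraph hG hN)
      (hasSeparators_netGraph hG hN h)⟩
  exact (hN n n.2 _ (hπN n) (hπ n)).symm

theorem coverable_preimage {π : V → N} (hπ : ∀ v, dist G v (π v) ≤ r) {T : Type*}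
    {q : N → T} {w : ℕ} {x : T} (hw : (q ⁻¹' {x}).encard ≤ w) :
    Coverable G w r {u | q (π u) = x} := by
  classical
  have hf := Set.finite_of_encard_le_coe hw
  rw [hf.encard_eq_coe_toFinset_card] at hw
  refine ⟨hf.toFinset.image Subtype.val, Finset.card_image_le.trans (by exact_mod_cast hw), fun u hu => ?_⟩
  refine Set.mem_biUnion (x := (π u).1) ?_ ?_
  · exact Finset.mem_image_of_mem _ (by simpa using hu)
  · rw [mem_ball, dist_comm]
    exact_mod_cast hπ u

/-- Pull the bags back along `q ∘ π`. Vertices at distance at most `r` project to equal or adjacent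
net points, which gives the spread; as `1 ≤ r`, it also handles the edges of `G`. -/
theorem SeparatorCond.treePartitionCond {G : FiniteGraph.{u}} {k m : ℕ} (hr : 0 < r)
    (h : SeparatorCond r k G) (hG : DoublingDimLE G.graph m) :
    TreePartitionCond r (netPartitionWidth m k) (netPartitionWidth m k + 1) G := by
  obtain ⟨N, π, hπ, -, -, T, hT, F, q, hF, hdeg, hadj, hw⟩ := h.exists_tree_map hG
  have hspread : ∀ u v, dist G.graph u v ≤ r →
      (∃ x, q (π u) = x ∧ q (π v) = x) ∨ ∃ x y, F.Adj x y ∧ q (π u) = x ∧ q (π v) = y := by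
    intro u v huv
    have : q (π u) = q (π v) ∨ F.Adj (q (π u)) (q (π v)) :=
      (netGraph_near hπ huv).elim (fun h => .inl (congrArg q h)) (hadj _ _)
    exact this.imp (fun h => ⟨_, h, rfl⟩) fun h => ⟨_, _, h, rfl, rfl⟩
  refine ⟨⟨T, F, hF, fun x => {u | q (π u) = x}, fun u => ⟨_, rfl, fun _ h => h.symm⟩,
    fun u v huv => hspread u v ((dist_le_one_of_adj huv).trans (by exact_mod_cast hr))⟩,
    hspread, hdeg, fun x => coverable_preimage hπ (hw x)⟩

theorem SeparatorCond.quasiIsometryCond {G : FiniteGraph.{u}} {k m : ℕ} (hr : 0 < r)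
    (h : SeparatorCond r k G) (hG : DoublingDimLE G.graph m) :
    QuasiIsometryCond r (netPartitionWidth m k) (8 ^ m) G := by
  obtain ⟨N, π, hπ, hπN, hdegN, T, hT, F, q, hF, -, hadj, hw⟩ := h.exists_tree_map hG
  refine ⟨weightedNetGraph G.graph r N, ⟨⟨T, F, hF, fun x => q ⁻¹' {x},
    fun u => ⟨_, rfl, fun _ h => h.symm⟩, fun a b hab => ?_⟩, hw⟩, hdegN, fun _ => rfl,
    π, isQuasiIsometry_netGraph hr hπ hπN⟩
  exact (hadj a b hab).imp (fun h => ⟨_, h, rfl⟩) fun h => ⟨_, _, h, rfl, rfl⟩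

/-- A tree-partition gives a tree decomposition in which every bag is enlarged by the
bags of the adjacent nodes. -/
theorem TreePartitionCond.treeDecompositionCond {G : FiniteGraph.{u}} {k Δ : ℕ}
    (h : TreePartitionCond r k Δ G) : TreeDecompositionCond r ((Δ + 1) * k) G := by
  classical
  obtain ⟨P, -, hdeg, hcov⟩ := h
  have := P.node_finite
  choose n hn huniq using P.existsUnique_mem
  -- The nodes whose enlarged bags contain `u` form a star centred at `n u`.
  have hconn : ∀ u, (P.tree.induce {x | x = n u ∨ P.tree.Adj (n u) x}).Connected := by
    intro u
    have hroot : ∀ x : {x | x = n u ∨ P.tree.Adj (n u) x},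
        (P.tree.induce {x | x = n u ∨ P.tree.Adj (n u) x}).Reachable ⟨n u, .inl rfl⟩ x := by
      rintro ⟨x, rfl | hx⟩
      · rfl
      · exact SimpleGraph.Adj.reachable (G := P.tree.induce _) hx
    have : Nonempty {x | x = n u ∨ P.tree.Adj (n u) x} := ⟨⟨n u, .inl rfl⟩⟩
    exact ⟨fun x y => (hroot x).symm.trans (hroot y)⟩
  refine ⟨⟨P.node, P.tree, P.isTree, fun x => {u | x = n u ∨ P.tree.Adj (n u) x}, ?_, hconn⟩,
    fun x => ?_⟩
  · intro u v huv
    obtain ⟨x, hu, hv⟩ | ⟨x, y, hxy, hu, hv⟩ := P.edge_mem u v huv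
    · exact ⟨x, .inl (huniq u x hu), .inl (huniq v x hv)⟩
    · refine ⟨x, .inl (huniq u x hu), .inr ?_⟩
      rw [← huniq v y hv]
      exact hxy.symm
  · obtain ⟨M, hM, hadj⟩ := exists_finset_neighbors hdeg x
    refine ((Coverable.biUnion (insert x M) fun y _ => hcov y).mono ?_).subset ?_
    · exact Nat.mul_le_mul_right _ ((Finset.card_insert_le _ _).trans (Nat.succ_le_succ hM))
    · intro u hu
      refine Set.mem_biUnion (x := n u) ?_ (hn u)
      obtain hu | hu := hu
      · exact Finset.mem_insert.2 (.inl hu.symm)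
      · exact Finset.mem_insert_of_mem (hadj _ hu.symm)

theorem QuasiIsometryCond.generalQuasiIsometryCond {G : FiniteGraph.{u}} {k Δ : ℕ}
    (h : QuasiIsometryCond r k Δ G) : GeneralQuasiIsometryCond r k Δ 3 3 3 G :=
  let ⟨H, hP, hdeg, hw, hφ⟩ := h
  ⟨H, hP, hdeg, fun e => (hw e).ge, hφ⟩

end FromSeparator

/-! ### Assembling the equivalences and the uniform constants -/

section Conditions

/-- Every condition bounds the balanced separator number. -/
theorem exists_separator_constants (i : Condition) : ∃ g : ℕ → i.Constants → ℕ,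
    ∀ (m : ℕ) (G : FiniteGraph.{u}), DoublingDimLE G.graph m → ∀ r : ℕ, 0 < r →
      ∀ c : i.Constants, i.Holds r c G → SeparatorCond r (g m c) G := by
  cases i with
  | treePartition => exact ⟨fun _ c => c.1, fun m G _ r _ c h => h.separatorCond⟩
  | treeDecomposition => exact ⟨fun _ c => c, fun m G _ r _ c h => h.separatorCond⟩
  | separator => exact ⟨fun _ c => c, fun m G _ r _ c h => h⟩
  | quasiIsometry =>
    exact ⟨fun m c => quasiIsometrySeparatorBound m c.1 c.2 3 3 3, fun m G hG r hr c h =>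
      h.generalQuasiIsometryCond.separatorCond hr (by norm_num) (by norm_num) hG⟩
  | generalQuasiIsometry =>
    exact ⟨fun m c => quasiIsometrySeparatorBound m c.1 c.2.1 c.2.2.1 c.2.2.2.1 c.2.2.2.2,
      fun m G hG r hr c h =>
        GeneralQuasiIsometryCond.separatorCond hr c.2.2.1.2 c.2.2.2.2.2 hG h⟩

/-- A bound on the balanced separator number gives every condition. -/
theorem exists_constants_of_separator (j : Condition) : ∃ g : ℕ → ℕ → j.Constants,
    ∀ (m : ℕ) (G : FiniteGraph.{u}), DoublingDimLE G.graph m → ∀ r : ℕ, 0 < r →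
      ∀ k : ℕ, SeparatorCond r k G → j.Holds r (g m k) G := by
  cases j with
  | treePartition => exact ⟨fun _ _ => (_, _), fun m G hG r hr k h => h.treePartitionCond hr hG⟩
  | treeDecomposition =>
    exact ⟨fun _ _ => _, fun m G hG r hr k h => (h.treePartitionCond hr hG).treeDecompositionCond⟩
  | separator => exact ⟨fun _ k => k, fun m G _ r _ k h => h⟩
  | quasiIsometry => exact ⟨fun _ _ => (_, _), fun m G hG r hr k h => h.quasiIsometryCond hr hG⟩
  | generalQuasiIsometry =>
    exact ⟨fun _ _ => (_, _, ⟨3, by norm_num⟩, ⟨3, by norm_num⟩, ⟨3, by norm_num⟩),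
      fun m G hG r hr k h => (h.quasiIsometryCond hr hG).generalQuasiIsometryCond⟩

/-- Pass through the separator number. Both bounds are functions of `m` and the constants alone,
chosen before the class and the scale, which gives the independence of `r`. -/
theorem exists_constants (i j : Condition) : ∃ f : ℕ → i.Constants → j.Constants,
    ∀ (m : ℕ) (𝒞 : Set FiniteGraph.{u}), (∀ G ∈ 𝒞, DoublingDimLE G.graph m) →
      ∀ r : ℕ, 0 < r → ∀ c : i.Constants,
        (∀ G ∈ 𝒞, i.Holds r c G) → ∀ G ∈ 𝒞, j.Holds r (f m c) G := by
  obtain ⟨g, hg⟩ := exists_separator_constants.{u} i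
  obtain ⟨g', hg'⟩ := exists_constants_of_separator.{u} j
  exact ⟨fun m c => g' m (g m c), fun m 𝒞 hm r hr c h G hG =>
    hg' m G (hm G hG) r hr _ (hg m G (hm G hG) r hr c (h G hG))⟩

end Conditions

end CoarseTW

theorem theorem1p2 :
    (∀ (m : ℕ) (𝒞 : Set CoarseTW.FiniteGraph.{u}),
      (∀ G ∈ 𝒞, CoarseTW.DoublingDimLE G.graph m) →
      ∀ r : ℕ, 0 < r →
        List.TFAE [
          (∃ k₁ Δ₁ : ℕ, ∀ G ∈ 𝒞, CoarseTW.TreePartitionCond r k₁ Δ₁ G),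
          (∃ k₂ : ℕ, ∀ G ∈ 𝒞, CoarseTW.TreeDecompositionCond r k₂ G),
          (∃ k₃ : ℕ, ∀ G ∈ 𝒞, CoarseTW.SeparatorCond r k₃ G),
          (∃ k₄ Δ₄ : ℕ, ∀ G ∈ 𝒞, CoarseTW.QuasiIsometryCond r k₄ Δ₄ G),
          (∃ (k₅ Δ₅ : ℕ) (α β γ : ℝ≥0), 0 < α ∧ 0 < β ∧ 0 < γ ∧
            ∀ G ∈ 𝒞, CoarseTW.GeneralQuasiIsometryCond r k₅ Δ₅ α β γ G)]) ∧
    (∀ i j : CoarseTW.Condition, ∃ f : ℕ → i.Constants → j.Constants,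
      ∀ (m : ℕ) (𝒞 : Set CoarseTW.FiniteGraph.{u}),
        (∀ G ∈ 𝒞, CoarseTW.DoublingDimLE G.graph m) →
        ∀ r : ℕ, 0 < r → ∀ c : i.Constants,
          (∀ G ∈ 𝒞, i.Holds r c G) → ∀ G ∈ 𝒞, j.Holds r (f m c) G) := by
  refine ⟨fun m 𝒞 hm r hr => ?_, CoarseTW.exists_constants⟩
  -- The qualitative equivalence is the uniform statement with the constants existentially
  -- quantified.
  have key : ∀ i j : CoarseTW.Condition, (∃ c : i.Constants, ∀ G ∈ 𝒞, i.Holds r c G) →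
      ∃ c : j.Constants, ∀ G ∈ 𝒞, j.Holds r c G := fun i j ⟨c, h⟩ => by
    obtain ⟨f, hf⟩ := CoarseTW.exists_constants i j
    exact ⟨f m c, hf m 𝒞 hm r hr c h⟩
  tfae_have 1 → 2 := fun ⟨k, Δ, h⟩ => key .treePartition .treeDecomposition ⟨(k, Δ), h⟩
  tfae_have 2 → 3 := key .treeDecomposition .separator
  tfae_have 3 → 4 := fun h =>
    let ⟨c, h⟩ := key .separator .quasiIsometry h
    ⟨c.1, c.2, h⟩
  tfae_have 4 → 5 := fun ⟨k, Δ, h⟩ =>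
    let ⟨c, h⟩ := key .quasiIsometry .generalQuasiIsometry ⟨(k, Δ), h⟩
    ⟨c.1, c.2.1, c.2.2.1, c.2.2.2.1, c.2.2.2.2, c.2.2.1.2, c.2.2.2.1.2, c.2.2.2.2.2, h⟩
  tfae_have 5 → 1 := fun ⟨k, Δ, α, β, γ, hα, hβ, hγ, h⟩ =>
    let ⟨c, h⟩ := key .generalQuasiIsometry .treePartition
      ⟨(k, Δ, ⟨α, hα⟩, ⟨β, hβ⟩, ⟨γ, hγ⟩), h⟩
    ⟨c.1, c.2, h⟩
  tfae_finish
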